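/- Let $G=(V,E,\mu,w)$ be a connected, locally finite weighted graph, with vertex measure $\mu:V\to(0,\infty)$ and symmetric edge weights $w_{xy}=w_{yx}>0$ ($x\sim y$). Write $\int_V u\,d\mu=\sum_{x\in V}u(x)\mu(x)$ and $\|u\|_2=(\int_V u^2d\mu)^{1/2}$. Let $\Delta u(x)=\frac1{\mu(x)}\sum_{y\sim x}w_{xy}(u(y)-u(x))$ and let $p(t,x,y)$ be the heat kernel of $G$, that is, the increasing limit, over finite sets $D\subset V$, of the Dirichlet heat kernels $p_D(t,x,y)=e^{t\Delta_D}(\delta_y/\mu(y))(x)$, where $\Delta_D$ is $\Delta$ acting on functions vanishing outside $D$ and restricted to $D$. Assume that $G$ is stochastically complete: $\sum_{y\in V}p(t,x,y)\mu(y)=1$ for all $t>0$, $x\in V$. Let $s\in(0,1)$ and put, for $x\ne y$, $$W_s(x,y)=\frac{s}{\Gamma(1-s)}\,\mu(x)\mu(y)\int_0^{\infty}p(t,x,y)\,t^{-1-s}\,dt,$$ and, for bounded functions $u,v$ on $V$, $$(-\Delta)^su(x)=\frac1{\mu(x)}\sum_{y\ne x}W_s(x,y)(u(x)-u(y)),\qquad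 \nabla^su\nabla^sv(x)=\frac1{2\mu(x)}\sum_{y\ne x}W_s(x,y)(u(x)-u(y))(v(x)-v(y)),$$ with $|\nabla^su|^2=\nabla^su\nabla^su$. Suppose $\inf_V\mu>0$, and let $h:V\to\mathbb R$ satisfy $\inf_Vh>0$ and, for every fixed $x_0\in V$, $h(x)\to+\infty$ as $\mathrm d(x,x_0)\to+\infty$, where $\mathrm d$ is the graph distance (least number of edges of a path). Let $\mathscr H_s$ be the completion of the space $C_c(V)$ of finitely supported functions under the norm $\|u\|_{\mathscr H_s}=\left(\int_V(|\nabla^su|^2+hu^2)\,d\mu\right)^{1/2}$, realised as the space of bounded functions $u$ on $V$ with $\|u\|_{\mathscr H_s}<\infty$ that are limits in this norm of functions in $C_c(V)$. Put $$\lambda_1=\inf_{u\in\mathscr H_s,\ u\not\equiv0}\frac{\|u\|_{\mathscr H_s}^2}{\|u\|_2^2}.$$ Let $f:V\times\mathbb R\to\mathbb R$ satisfy: (F1) for every $x\in V$, $f(x,\cdot)$ is continuous and $f(x,0)=0$; (F2) for every $M>0$ there is a constant $C_M$ with $|f(x,y)|\le C_M$ for all $(x,y)\in V\times[-M,M]$;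 (F3) there is $\alpha>2$ such that $0<\alpha F(x,y)\le y f(x,y)$ for all $x\in V$ and $y\in\mathbb R\setminus\{0\}$, where $F(x,y)=\int_0^yf(x,t)\,dt$; (F4) $\limsup_{y\to0}f(x,y)/y<\lambda_1$ uniformly in $x\in V$, that is, there are $c<\lambda_1$ and $\delta>0$ with $f(x,y)/y\le c$ for all $x\in V$ and $0<|y|<\delta$. Then the equation $$(-\Delta)^su+h(x)u=f(x,u)\quad\text{in }V$$ has at least two solutions in $\mathscr H_s$, one strictly positive ($u(x)>0$ for all $x\in V$) and one strictly negative ($u(x)<0$ for all $x\in V$). Here a solution is a function $u\in\mathscr H_s$ that is a weak solution, i.e. $\int_V(\nabla^su\nabla^s\varphi+hu\varphi)\,d\mu=\int_Vf(x,u)\varphi\,d\mu$ for all $\varphi\in\mathscr H_s$ (all series converging), and that also satisfies the equation at every vertex of $V$. -/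

import Mathlib

open Set Filter Topology MeasureTheory

/-- A weighted graph `(V, E, μ, w)`: a simple graph on `V`, a positive vertex measure `μ` and
positive symmetric edge weights `w`. Values of `w` on pairs that are not edges are never used. -/
structure WeightedGraph (V : Type*) where
  graph : SimpleGraph V
  μ : V → ℝ
  w : V → V → ℝ
  μ_pos : ∀ x, 0 < μ x
  w_pos : ∀ x y, graph.Adj x y → 0 < w x y
  w_symm : ∀ x y, graph.Adj x y → w x y = w y x

noncomputable section

namespace WeightedGraph

/-- `∫_V u dμ = ∑_{x ∈ V} u(x) μ(x)`. -/
def integral {V : Type*} (G : WeightedGraph V) (u : V → ℝ) : ℝ :=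
  ∑' x, u x * G.μ x

/-- (Absolute) convergence of the series `∫_V u dμ`. -/
def IsIntegrable {V : Type*} (G : WeightedGraph V) (u : V → ℝ) : Prop :=
  Summable fun x => u x * G.μ x

/-- The graph Laplacian `Δu(x) = μ(x)⁻¹ ∑_{y ∼ x} w_{xy} (u(y) - u(x))`. -/
def laplacian {V : Type*} (G : WeightedGraph V) [G.graph.LocallyFinite] (u : V → ℝ) (x : V) : ℝ :=
  (1 / G.μ x) * ∑ y ∈ G.graph.neighborFinset x, G.w x y * (u y - u x)

open Classical in
/-- The Dirichlet Laplacian of a finite vertex set `D`: the matrix of `u ↦ (Δu)|_D` on functions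
that vanish outside `D`. Its `(x, y)` entry is `Δδ_y(x)`. -/
def dirichletLaplacian {V : Type*} (G : WeightedGraph V) [G.graph.LocallyFinite] (D : Finset V) :
    Matrix D D ℝ :=
  Matrix.of fun x y => G.laplacian (Pi.single (y : V) (1 : ℝ)) (x : V)

open Classical in
/-- The Dirichlet heat kernel of a finite vertex set `D`, `p_D(t,x,y) = e^{tΔ_D}(δ_y/μ(y))(x)` for
`x, y ∈ D`, extended by zero. -/
def dirichletHeatKernel {V : Type*} (G : WeightedGraph V) [G.graph.LocallyFinite] (D : Finset V)
    (t : ℝ) (x y : V) : ℝ :=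
  if h : x ∈ D ∧ y ∈ D then
    (NormedSpace.exp (t • G.dirichletLaplacian D) : Matrix D D ℝ) ⟨x, h.1⟩ ⟨y, h.2⟩ / G.μ y
  else 0

/-- The heat kernel `p(t,x,y)` of the graph (`t ≥ 0`): the increasing limit of the Dirichlet heat
kernels along the finite vertex sets. For `t ≥ 0` one has `0 ≤ p_D(t,x,y) ≤ 1/μ(y)`, and `p_D` is
monotone in `D`, so the supremum is a genuine one and equals the limit along any exhaustion. -/
def heatKernel {V : Type*} (G : WeightedGraph V) [G.graph.LocallyFinite] (t : ℝ) (x y : V) : ℝ :=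
  ⨆ D : Finset V, G.dirichletHeatKernel D t x y

/-- `∑_y p(t,x,y) μ(y) = 1` for all `t > 0` and all `x`. -/
def StochasticallyComplete {V : Type*} (G : WeightedGraph V) [G.graph.LocallyFinite] : Prop :=
  ∀ t : ℝ, 0 < t → ∀ x, HasSum (fun y => G.heatKernel t x y * G.μ y) 1

open Classical in
/-- The kernel `W_s(x,y) = s/Γ(1-s) μ(x) μ(y) ∫_0^∞ p(t,x,y) t^{-1-s} dt` for `x ≠ y`, extended
by `0` to the diagonal. -/
def fracKernel {V : Type*} (G : WeightedGraph V) [G.graph.LocallyFinite] (s : ℝ) (x y : V) : ℝ :=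
  if x = y then 0
  else s / Real.Gamma (1 - s) * G.μ x * G.μ y *
    ∫ t in Ioi (0 : ℝ), G.heatKernel t x y * t ^ (-1 - s)

/-- The fractional Laplacian
`(-Δ)^s u(x) = μ(x)⁻¹ ∑_{y ≠ x} W_s(x,y) (u(x) - u(y))` (for bounded `u`). -/
def fracLaplacian {V : Type*} (G : WeightedGraph V) [G.graph.LocallyFinite] (s : ℝ) (u : V → ℝ)
    (x : V) : ℝ :=
  (1 / G.μ x) * ∑' y, G.fracKernel s x y * (u x - u y)

/-- The product of fractional gradients
`∇^s u ∇^s v (x) = (2μ(x))⁻¹ ∑_{y ≠ x} W_s(x,y) (u(x) - u(y)) (v(x) - v(y))` (for bounded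
`u`, `v`). -/
def gradInner {V : Type*} (G : WeightedGraph V) [G.graph.LocallyFinite] (s : ℝ) (u v : V → ℝ)
    (x : V) : ℝ :=
  (1 / (2 * G.μ x)) * ∑' y, G.fracKernel s x y * (u x - u y) * (v x - v y)

/-- `‖u‖_2 = (∫_V u² dμ)^{1/2}`. -/
def l2Norm {V : Type*} (G : WeightedGraph V) (u : V → ℝ) : ℝ :=
  √(G.integral fun x => u x ^ 2)

/-- `‖u‖_{ℋ_s} = (∫_V (|∇^s u|² + h u²) dμ)^{1/2}`. -/
def hsNorm {V : Type*} (G : WeightedGraph V) [G.graph.LocallyFinite] (s : ℝ) (h : V → ℝ)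
    (u : V → ℝ) : ℝ :=
  √(G.integral fun x => G.gradInner s u u x + h x * u x ^ 2)

/-- The space `ℋ_s`, the completion of `C_c(V)` for `‖·‖_{ℋ_s}`, realised as a space of functions:
all bounded functions of finite `ℋ_s` norm that are `ℋ_s`-limits of finitely supported functions. -/
def hs {V : Type*} (G : WeightedGraph V) [G.graph.LocallyFinite] (s : ℝ) (h : V → ℝ) :
    Set (V → ℝ) :=
  {u | (∃ C : ℝ, ∀ x, |u x| ≤ C) ∧
    G.IsIntegrable (fun x => G.gradInner s u u x + h x * u x ^ 2) ∧
    ∃ φ : ℕ → V → ℝ, (∀ n, (Function.support (φ n)).Finite) ∧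
      Tendsto (fun n => G.hsNorm s h (fun x => u x - φ n x)) atTop (𝓝 0)}

/-- `λ_1 = inf {‖u‖²_{ℋ_s} / ‖u‖²_2 : u ∈ ℋ_s, u ≢ 0}`. -/
def lambda1 {V : Type*} (G : WeightedGraph V) [G.graph.LocallyFinite] (s : ℝ) (h : V → ℝ) : ℝ :=
  sInf {r | ∃ u ∈ G.hs s h, u ≠ 0 ∧ r = G.hsNorm s h u ^ 2 / G.l2Norm u ^ 2}

/-- `u ∈ ℋ_s` is a weak solution of `(-Δ)^s u + h u = f(x,u)`:
`∫_V (∇^s u ∇^s φ + h u φ) dμ = ∫_V f(x,u) φ dμ` for all `φ ∈ ℋ_s`, all series converging. -/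
def IsWeakSolution {V : Type*} (G : WeightedGraph V) [G.graph.LocallyFinite] (s : ℝ) (h : V → ℝ)
    (f : V → ℝ → ℝ) (u : V → ℝ) : Prop :=
  u ∈ G.hs s h ∧ ∀ φ ∈ G.hs s h,
    G.IsIntegrable (fun x => G.gradInner s u φ x + h x * u x * φ x) ∧
    G.IsIntegrable (fun x => f x (u x) * φ x) ∧
    G.integral (fun x => G.gradInner s u φ x + h x * u x * φ x) =
      G.integral (fun x => f x (u x) * φ x)

/-- `u` satisfies `(-Δ)^s u + h u = f(x,u)` at every vertex, the series that defines `(-Δ)^s u`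
converging everywhere. -/
def IsPointwiseSolution {V : Type*} (G : WeightedGraph V) [G.graph.LocallyFinite] (s : ℝ)
    (h : V → ℝ) (f : V → ℝ → ℝ) (u : V → ℝ) : Prop :=
  ∀ x, Summable (fun y => G.fracKernel s x y * (u x - u y)) ∧
    G.fracLaplacian s u x + h x * u x = f x (u x)

end WeightedGraph

end

/-! Write L = μ((-Δ)^s + h). Solutions are critical points of half the energy minus ∑ μ F. Instead
of a Palais–Smale argument in ℋ_s, the mountain pass theorem is applied on every finite set D of
vertices, to functions vanishing outside D and with f replaced by 0 on the negative axis; the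
Dirichlet solutions are then passed to the limit.

The estimates do not depend on D (`exists_dirichlet_solution`). The mountain pass level is at most
the maximum of the action on a segment in the direction δ_{x₀}, which involves x₀ alone, and (F3)
turns this level into an energy bound K. Lower bounds on h and μ turn K into a sup bound. A minimum
principle gives u ≥ 0. Finally u reaches δ somewhere, since otherwise (F4) would bound the energy by
c‖u‖₂², with c < λ₁.

By Tychonoff the solutions converge pointwise along an ultrafilter. As W_s(x,·) is summable,
dominated convergence preserves the equation. As h tends to infinity and balls are finite, every set
{h ≤ R} is finite: the points where u reaches δ cannot escape, so the limit is nonzero, and no part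
of ∑ μ f(u) u is lost, which upgrades pointwise to strong convergence and puts the limit in ℋ_s
(`mem_hs_of_tendsto`). Positivity is the strong maximum principle (`pos_of_schrodinger_eq`), the
weak form follows by density of finitely supported functions (`isWeakSolution`), and the negative
solution comes from the nonlinearity -f(x,-y).

Summability of W_s(x,·) rests on the heat kernel: the mass outside x at time t is at most min(1,
ct), with c the weighted degree, and this is integrable against t^{-1-s} (`summable_fracKernel`). -/

/-- A weak form of Ekeland's variational principle. -/
theorem ekeland_variational_principle {Y : Type*} [MetricSpace Y] [CompleteSpace Y] (Ψ : Y → ℝ)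
    (hΨ : LowerSemicontinuous Ψ) {m : ℝ} (hm : ∀ y, m ≤ Ψ y) {ε : ℝ} (hε : 0 < ε) (y₀ : Y) :
    ∃ y, Ψ y + ε * dist y₀ y ≤ Ψ y₀ ∧ ∀ z, Ψ y ≤ Ψ z + ε * dist y z := by
  -- Membership in `S y` is a partial order with closed lower sets. A minimal element is built as
  -- the limit of a descending sequence that nearly minimises Ψ at each step.
  set S : Y → Set Y := fun y => {z | Ψ z + ε * dist y z ≤ Ψ y} with hS
  have hself : ∀ y, y ∈ S y := fun y => by simp [hS]
  have htrans : ∀ {a b c}, b ∈ S a → c ∈ S b → c ∈ S a := by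
    intro a b c hb hc
    simp only [hS, mem_ofPred_eq] at hb hc ⊢
    have := mul_le_mul_of_nonneg_left (dist_triangle a b c) hε.le
    linarith
  have hclosed : ∀ y, IsClosed (S y) := by
    intro y
    have : LowerSemicontinuous fun z => Ψ z + ε * dist y z :=
      hΨ.add (by fun_prop : Continuous fun z => ε * dist y z).lowerSemicontinuous
    exact this.isClosed_preimage (Ψ y)
  have hbdd : ∀ y, BddBelow (Ψ '' S y) := fun y => ⟨m, by rintro _ ⟨z, _, rfl⟩; exact hm z⟩
  have hnext : ∀ (n : ℕ) (y : Y), ∃ z ∈ S y, ∀ w ∈ S y, Ψ z ≤ Ψ w + (1 / 2 : ℝ) ^ n := by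
    intro n y
    obtain ⟨_, ⟨z, hz, rfl⟩, hlt⟩ := exists_lt_of_csInf_lt (⟨_, y, hself y, rfl⟩ :
      (Ψ '' S y).Nonempty)
      (lt_add_of_pos_right (sInf (Ψ '' S y)) (by positivity : (0 : ℝ) < (1 / 2) ^ n))
    exact ⟨z, hz, fun w hw => hlt.le.trans (by gcongr; exact csInf_le (hbdd y) ⟨w, hw, rfl⟩)⟩
  choose next hnext_mem hnext_le using hnext
  set y : ℕ → Y := fun n => Nat.rec y₀ next n with hy
  have hy_succ : ∀ n, y (n + 1) = next n (y n) := fun n => rfl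
  have hstep : ∀ n, y (n + 1) ∈ S (y n) := fun n => hnext_mem n (y n)
  have hmono : ∀ {n k}, n ≤ k → y k ∈ S (y n) := by
    intro n k hnk
    induction k, hnk using Nat.le_induction with
    | base => exact hself _
    | succ k _ ih => exact htrans ih (hstep k)
  have hanti : Antitone fun n => Ψ (y n) := by
    intro n k hnk
    have h1 : Ψ (y k) + ε * dist (y n) (y k) ≤ Ψ (y n) := hmono hnk
    have h2 : 0 ≤ ε * dist (y n) (y k) := by positivity
    show Ψ (y k) ≤ Ψ (y n)
    linarith
  have hlim : Tendsto (fun n => Ψ (y n)) atTop (𝓝 (⨅ n, Ψ (y n))) :=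
    tendsto_atTop_ciInf hanti ⟨m, by rintro _ ⟨n, rfl⟩; exact hm _⟩
  have hcauchy : CauchySeq y := by
    refine cauchySeq_of_le_tendsto_0' (fun n => (Ψ (y n) - ⨅ n, Ψ (y n)) / ε) (fun n k hnk => ?_) ?_
    · have h1 : Ψ (y k) + ε * dist (y n) (y k) ≤ Ψ (y n) := hmono hnk
      have h2 : ⨅ n, Ψ (y n) ≤ Ψ (y k) := ciInf_le ⟨m, by rintro _ ⟨n, rfl⟩; exact hm _⟩ k
      rw [le_div_iff₀ hε]
      linarith
    · simpa using (hlim.sub_const (⨅ n, Ψ (y n))).div_const ε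
  obtain ⟨a, ha⟩ := cauchySeq_tendsto_of_complete hcauchy
  have haS : ∀ n, a ∈ S (y n) := fun n =>
    (hclosed (y n)).mem_of_tendsto ha ((eventually_ge_atTop n).mono fun k hk => hmono hk)
  refine ⟨a, haS 0, fun z => ?_⟩
  by_contra! hz
  have hzS : z ∈ S a := hz.le
  -- A point `z` below `a` lies below every `y n`, over which `y (n + 1)` was minimal up to 2^{-n};
  -- in the limit Ψ a ≤ Ψ z.
  have h1 : ∀ n, Ψ a ≤ Ψ z + (1 / 2 : ℝ) ^ n := by
    intro n
    have h2 : Ψ a + ε * dist (y (n + 1)) a ≤ Ψ (y (n + 1)) := haS (n + 1)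
    have h3 := hnext_le n (y n) z (htrans (haS n) hzS)
    rw [← hy_succ] at h3
    have : 0 ≤ ε * dist (y (n + 1)) a := by positivity
    linarith
  have h2 : Ψ a ≤ Ψ z := by
    have : Tendsto (fun n : ℕ => Ψ z + (1 / 2 : ℝ) ^ n) atTop (𝓝 (Ψ z + 0)) :=
      (tendsto_pow_atTop_nhds_zero_of_lt_one (by norm_num) (by norm_num)).const_add _
    rw [add_zero] at this
    exact ge_of_tendsto' this h1
  have : 0 ≤ ε * dist a z := by positivity
  linarith

/-! ### Mountain pass theorem by Ekeland's principle on the space of paths -/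

section MountainPass

variable {X : Type*} [NormedAddCommGroup X] [InnerProductSpace ℝ X]

/-- Moving the path a distance at most s against the gradient lowers its maximum by at most εs.
Letting s → 0, a limit of maximum points of the moved paths is a maximum point of γ where the slope
in the normalised gradient direction is at most ε. -/
theorem exists_norm_gradient_le_of_almost_minimal_path {I : X → ℝ} {g : X → X}
    (hI : ∀ u, HasFDerivAt I (innerSL ℝ (g u)) u) (hg : Continuous g) {e : X} (hI0 : I 0 = 0)
    (hIe : I e ≤ 0) {ε : ℝ} (hε : 0 < ε) (γ : C(unitInterval, X)) (hγ0 : γ 0 = 0) (hγ1 : γ 1 = e)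
    (hpos : 0 < ⨆ t, I (γ t))
    (hmin : ∀ γ' : C(unitInterval, X), γ' 0 = 0 → γ' 1 = e →
      ⨆ t, I (γ t) ≤ (⨆ t, I (γ' t)) + ε * dist γ γ') :
    ∃ u, I u = ⨆ t, I (γ t) ∧ ‖g u‖ ≤ ε := by
  have hIc : Continuous I := continuous_iff_continuousAt.2 fun u => (hI u).continuousAt
  set M := ⨆ t, I (γ t) with hM
  have hle : ∀ t, I (γ t) ≤ M := fun t =>
    le_ciSup (isCompact_range (by fun_prop : Continuous fun t => I (γ t))).bddAbove t
  -- The first factor vanishes where I ≤ 0, so the endpoints stay fixed, and equals 1 at the maxima.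
  -- Dividing by the larger of ‖g‖ and ε keeps the field continuous and of norm at most 1.
  set w : unitInterval → X := fun t =>
    (max 0 (I (γ t) / M)) • ((max ‖g (γ t)‖ ε)⁻¹ • g (γ t)) with hw
  have hmaxpos : ∀ t, 0 < max ‖g (γ t)‖ ε := fun t => hε.trans_le (le_max_right _ _)
  have hwc : Continuous w := by
    refine Continuous.smul (by fun_prop) (Continuous.smul (Continuous.inv₀ (by fun_prop) ?_)
      (by fun_prop))
    exact fun t => (hmaxpos t).ne'
  have hw1 : ∀ t, ‖w t‖ ≤ 1 := by
    intro t
    rw [hw, norm_smul, norm_smul, norm_inv, Real.norm_of_nonneg (hmaxpos t).le,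
      Real.norm_of_nonneg (le_max_left _ _)]
    refine mul_le_one₀ (max_le zero_le_one ((div_le_one hpos).2 (hle t))) (by positivity) ?_
    rw [inv_mul_le_one₀ (hmaxpos t)]
    exact le_max_left _ _
  have key : ∀ s : ℝ, 0 < s → ∃ t : unitInterval, ∃ r ∈ Icc 0 s,
      M - ε * s ≤ I (γ t - s • w t) ∧ inner ℝ (g (γ t - r • w t)) (w t) ≤ ε := by
    intro s hs
    set γ' : C(unitInterval, X) := ⟨fun t => γ t - s • w t, by fun_prop⟩ with hγ'
    have hend : ∀ t, I (γ t) ≤ 0 → γ' t = γ t := by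
      intro t ht
      have : max 0 (I (γ t) / M) = 0 := max_eq_left (div_nonpos_of_nonpos_of_nonneg ht hpos.le)
      simp [hγ', hw, this]
    have h1 := hmin γ' (by rw [hend 0 (by rw [hγ0, hI0]), hγ0])
      (by rw [hend 1 (by rwa [hγ1]), hγ1])
    have hd : dist γ γ' ≤ s := by
      rw [ContinuousMap.dist_le hs.le]
      intro t
      rw [dist_eq_norm]
      have : γ t - γ' t = s • w t := by simp [hγ']
      rw [this, norm_smul, Real.norm_of_nonneg hs.le]
      nlinarith [hw1 t]
    obtain ⟨t, -, ht⟩ := isCompact_univ.exists_isMaxOn (univ_nonempty (α := unitInterval))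
      (by fun_prop : Continuous fun t => I (γ' t)).continuousOn
    have h2 : (⨆ t, I (γ' t)) ≤ I (γ' t) := ciSup_le fun t' => ht (mem_univ t')
    have h3 : M - ε * s ≤ I (γ t - s • w t) := by
      have : ε * dist γ γ' ≤ ε * s := by gcongr
      have h4 : I (γ' t) = I (γ t - s • w t) := rfl
      linarith
    have hder : ∀ r : ℝ, HasDerivAt (fun r : ℝ => I (γ t - r • w t))
        (-inner ℝ (g (γ t - r • w t)) (w t)) r := by
      intro r
      have h5 : HasDerivAt (fun r : ℝ => γ t - r • w t) (-w t) r := by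
        simpa using ((hasDerivAt_id r).smul_const (w t)).const_sub (γ t)
      simpa [Function.comp_def] using (hI (γ t - r • w t)).comp_hasDerivAt r h5
    obtain ⟨r, hr, hreq⟩ := exists_hasDerivAt_eq_slope (fun r : ℝ => I (γ t - r • w t)) _ hs
      (fun r _ => (hder r).continuousAt.continuousWithinAt) fun r _ => hder r
    refine ⟨t, r, Ioo_subset_Icc_self hr, h3, ?_⟩
    simp only [zero_smul, sub_zero] at hreq
    have h6 := hle t
    rw [eq_div_iff hs.ne'] at hreq
    by_contra! hcon
    nlinarith [mul_lt_mul_of_pos_right hcon hs]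
  set s : ℕ → ℝ := fun n => 1 / ((n : ℝ) + 1) with hs
  have hs0 : Tendsto s atTop (𝓝 0) := tendsto_one_div_add_atTop_nhds_zero_nat
  have hspos : ∀ n, 0 < s n := fun n => by positivity
  choose t r hr hIt hin using fun n => key (s n) (hspos n)
  obtain ⟨a, -, φ, hφ, ha⟩ := isCompact_univ.tendsto_subseq (x := t) fun n => mem_univ _
  have hsφ : Tendsto (fun n => s (φ n)) atTop (𝓝 0) := hs0.comp hφ.tendsto_atTop
  have hrφ : Tendsto (fun n => r (φ n)) atTop (𝓝 0) :=
    squeeze_zero (fun n => (hr (φ n)).1) (fun n => (hr (φ n)).2) hsφ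
  have hγa : Tendsto (fun n => γ (t (φ n))) atTop (𝓝 (γ a)) := (γ.continuous.tendsto a).comp ha
  have hwa : Tendsto (fun n => w (t (φ n))) atTop (𝓝 (w a)) := (hwc.tendsto a).comp ha
  have hIa : M ≤ I (γ a) := by
    have h1 : Tendsto (fun n => I (γ (t (φ n)) - s (φ n) • w (t (φ n)))) atTop
        (𝓝 (I (γ a - (0 : ℝ) • w a))) := (hIc.tendsto _).comp (hγa.sub (hsφ.smul hwa))
    have h2 : Tendsto (fun n => M - ε * s (φ n)) atTop (𝓝 (M - ε * 0)) :=
      (hsφ.const_mul ε).const_sub M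
    simpa using le_of_tendsto_of_tendsto' h2 h1 fun n => hIt (φ n)
  have hIa' : I (γ a) = M := le_antisymm (hle a) hIa
  refine ⟨γ a, hIa', ?_⟩
  have h1 : Tendsto (fun n => inner ℝ (g (γ (t (φ n)) - r (φ n) • w (t (φ n)))) (w (t (φ n)))) atTop
      (𝓝 (inner ℝ (g (γ a - (0 : ℝ) • w a)) (w a))) :=
    ((hg.tendsto _).comp (hγa.sub (hrφ.smul hwa))).inner hwa
  have h2 := le_of_tendsto' h1 fun n => hin (φ n)
  have h3 : w a = (max ‖g (γ a)‖ ε)⁻¹ • g (γ a) := by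
    simp only [hw]
    rw [hIa', div_self hpos.ne', max_eq_right zero_le_one, one_smul]
  rw [zero_smul, sub_zero, h3, inner_smul_right, real_inner_self_eq_norm_sq,
    inv_mul_le_iff₀ (hmaxpos a)] at h2
  by_contra! hcon
  rw [max_eq_left hcon.le] at h2
  nlinarith [norm_nonneg (g (γ a))]

/-- Paths from 0 to e form a closed set of continuous maps, and the maximum of I along a path is
lower semicontinuous and at least ρ, because each path crosses the sphere. Starting Ekeland's
principle at the straight segment yields the upper bound c. -/
theorem exists_norm_gradient_le_of_mountain_pass [CompleteSpace X] {I : X → ℝ} {g : X → X}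
    (hI : ∀ u, HasFDerivAt I (innerSL ℝ (g u)) u) (hg : Continuous g) {e : X} (hI0 : I 0 = 0)
    (hIe : I e ≤ 0) {r ρ : ℝ} (hr : 0 ≤ r) (hre : r ≤ ‖e‖) (hρ : 0 < ρ)
    (hsphere : ∀ u, ‖u‖ = r → ρ ≤ I u) {c : ℝ} (hc : ∀ t ∈ Icc (0 : ℝ) 1, I (t • e) ≤ c)
    {ε : ℝ} (hε : 0 < ε) : ∃ u, ρ ≤ I u ∧ I u ≤ c ∧ ‖g u‖ ≤ ε := by
  have hIc : Continuous I := continuous_iff_continuousAt.2 fun u => (hI u).continuousAt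
  let Y := {γ : C(unitInterval, X) // γ 0 = 0 ∧ γ 1 = e}
  have hYc : IsClosed {γ : C(unitInterval, X) | γ 0 = 0 ∧ γ 1 = e} :=
    (isClosed_eq (continuous_eval_const 0) continuous_const).inter
      (isClosed_eq (continuous_eval_const 1) continuous_const)
  have : CompleteSpace Y := hYc.completeSpace_coe
  have hbdd : ∀ γ : C(unitInterval, X), BddAbove (range fun t => I (γ t)) := fun γ =>
    (isCompact_range (by fun_prop : Continuous fun t => I (γ t))).bddAbove
  set Ψ : Y → ℝ := fun γ => ⨆ t, I (γ.1 t) with hΨ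
  have hlsc : LowerSemicontinuous Ψ := by
    refine lowerSemicontinuous_ciSup (fun γ => hbdd γ.1) fun t => Continuous.lowerSemicontinuous ?_
    exact hIc.comp ((continuous_eval_const t).comp continuous_subtype_val)
  have hΨρ : ∀ γ : Y, ρ ≤ Ψ γ := by
    intro γ
    have h1 : r ∈ Icc ‖γ.1 0‖ ‖γ.1 1‖ := by
      rw [γ.2.1, γ.2.2, norm_zero]
      exact ⟨hr, hre⟩
    obtain ⟨t, ht⟩ := mem_range_of_exists_le_of_exists_ge
      γ.1.continuous.norm ⟨0, h1.1⟩ ⟨1, h1.2⟩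
    exact (hsphere _ ht).trans (le_ciSup (hbdd γ.1) t)
  set y₀ : Y := ⟨⟨fun t => (t : ℝ) • e, by fun_prop⟩, by simp, by simp⟩
  obtain ⟨γ, hγ, hγmin⟩ := ekeland_variational_principle Ψ hlsc hΨρ hε y₀
  obtain ⟨u, hu, hgu⟩ := exists_norm_gradient_le_of_almost_minimal_path hI hg hI0 hIe hε γ.1 γ.2.1
    γ.2.2 (hρ.trans_le (hΨρ γ)) fun γ' h0 h1 => hγmin ⟨γ', h0, h1⟩
  refine ⟨u, hu ▸ hΨρ γ, ?_, hgu⟩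
  have h1 : Ψ y₀ ≤ c := ciSup_le fun t => hc t t.2
  have h2 : 0 ≤ ε * dist y₀ γ := by positivity
  have h3 : I u = Ψ γ := hu
  linarith

/-- The mountain pass theorem in finite dimension. -/
theorem exists_critical_point_of_mountain_pass [FiniteDimensional ℝ X] {I : X → ℝ} {g : X → X}
    (hI : ∀ u, HasFDerivAt I (innerSL ℝ (g u)) u) (hg : Continuous g) {e : X} (hI0 : I 0 = 0)
    (hIe : I e ≤ 0) {r ρ : ℝ} (hr : 0 ≤ r) (hre : r ≤ ‖e‖) (hρ : 0 < ρ)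
    (hsphere : ∀ u, ‖u‖ = r → ρ ≤ I u) {c : ℝ} (hc : ∀ t ∈ Icc (0 : ℝ) 1, I (t • e) ≤ c)
    {R : ℝ} (hPS : ∀ u, I u ≤ c → ‖g u‖ ≤ 1 → ‖u‖ ≤ R) :
    ∃ u, ρ ≤ I u ∧ I u ≤ c ∧ g u = 0 := by
  have : CompleteSpace X := FiniteDimensional.complete ℝ X
  have : ProperSpace X := FiniteDimensional.proper ℝ X
  have hIc : Continuous I := continuous_iff_continuousAt.2 fun u => (hI u).continuousAt
  have hspos : ∀ n : ℕ, 0 < 1 / ((n : ℝ) + 1) := fun n => by positivity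
  choose u hu1 hu2 hu3 using fun n => exists_norm_gradient_le_of_mountain_pass hI hg hI0 hIe hr hre
    hρ hsphere hc (hspos n)
  have hball : ∀ n, u n ∈ Metric.closedBall (0 : X) R := fun n => by
    rw [mem_closedBall_zero_iff]
    refine hPS _ (hu2 n) ((hu3 n).trans ?_)
    rw [div_le_one (by positivity)]
    linarith [n.cast_nonneg (α := ℝ)]
  obtain ⟨a, -, φ, hφ, ha⟩ := (isCompact_closedBall (0 : X) R).tendsto_subseq hball
  have hIa := (hIc.tendsto a).comp ha
  refine ⟨a, ge_of_tendsto' hIa fun n => hu1 _, le_of_tendsto' hIa fun n => hu2 _, ?_⟩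
  have h1 : Tendsto (fun n => ‖g (u (φ n))‖) atTop (𝓝 ‖g a‖) := ((hg.tendsto a).comp ha).norm
  have h2 : Tendsto (fun n => 1 / ((φ n : ℝ) + 1)) atTop (𝓝 0) :=
    tendsto_one_div_add_atTop_nhds_zero_nat.comp hφ.tendsto_atTop
  exact norm_le_zero_iff.1 (le_of_tendsto_of_tendsto' h1 h2 fun n => hu3 _)

end MountainPass

/-! ### Superlinear variational systems on a finite index set -/

section FiniteSystem

variable {ι : Type*} [Fintype ι]

/-- The quadratic energy of a vector for a real matrix, minus the potential of a nonlinearity. -/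
noncomputable def latticeAction (a : ι → ι → ℝ) (k : ι → ℝ → ℝ) (u : ι → ℝ) : ℝ :=
  1 / 2 * ∑ x, ∑ y, a x y * u x * u y - ∑ x, ∫ t in (0 : ℝ)..u x, k x t

theorem hasFDerivAt_latticeAction {a : ι → ι → ℝ} (ha : ∀ x y, a x y = a y x) {k : ι → ℝ → ℝ}
    (hk : ∀ x, Continuous (k x)) (u : EuclideanSpace ℝ ι) :
    HasFDerivAt (fun v : EuclideanSpace ℝ ι => latticeAction a k v)
      (innerSL ℝ (WithLp.toLp 2 fun x => ∑ y, a x y * u y - k x (u x) : EuclideanSpace ℝ ι)) u := by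
  have hp : ∀ x, HasFDerivAt (fun v : EuclideanSpace ℝ ι => v x)
      (EuclideanSpace.proj x : EuclideanSpace ℝ ι →L[ℝ] ℝ) u := fun x =>
    (EuclideanSpace.proj x : EuclideanSpace ℝ ι →L[ℝ] ℝ).hasFDerivAt
  have h1 := (HasFDerivAt.fun_sum fun x (_ : x ∈ Finset.univ) =>
    HasFDerivAt.fun_sum fun y (_ : y ∈ Finset.univ) =>
      ((hp x).const_mul (a x y)).mul (hp y)).const_mul (1 / 2 : ℝ)
  have h2 := HasFDerivAt.fun_sum fun x (_ : x ∈ Finset.univ) =>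
    ((hk x).integral_hasStrictDerivAt 0 (u x)).hasDerivAt.comp_hasFDerivAt u (hp x)
  refine (h1.sub h2).congr_fderiv ?_
  ext v
  simp only [one_div, sub_apply, smul_apply,
    sum_apply, add_apply, PiLp.proj_apply,
    smul_eq_mul, innerSL_apply_apply, PiLp.inner_apply, RCLike.inner_apply, conj_trivial]
  have h3 : ∑ x, ∑ y, (a x y * u x * v y + u y * (a x y * v x)) =
      2 * ∑ x, ∑ y, v x * (a x y * u y) := by
    simp only [Finset.sum_add_distrib]
    rw [Finset.sum_comm, two_mul]
    congr 1 <;> refine Finset.sum_congr rfl fun x _ => Finset.sum_congr rfl fun y _ => ?_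
    · rw [ha y x]; ring
    · ring
  rw [h3, inv_mul_cancel_left₀ two_ne_zero, ← Finset.sum_sub_distrib]
  refine Finset.sum_congr rfl fun x _ => ?_
  rw [mul_sub, Finset.mul_sum]
  ring

/-- The Ambrosetti–Rabinowitz computation of αI(u) - ⟨I'(u), u⟩. It bounds almost critical points,
and later gives the energy bound for exact ones. -/
theorem energy_le_latticeAction {a : ι → ι → ℝ} {k : ι → ℝ → ℝ} {α : ℝ}
    (hAR : ∀ x y, α * (∫ t in (0 : ℝ)..y, k x t) ≤ y * k x y) (u : ι → ℝ) :
    (α / 2 - 1) * ∑ x, ∑ y, a x y * u x * u y +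
      ∑ x, u x * (∑ y, a x y * u y - k x (u x)) ≤ α * latticeAction a k u := by
  have h1 : ∑ x, α * (∫ t in (0 : ℝ)..u x, k x t) ≤ ∑ x, u x * k x (u x) :=
    Finset.sum_le_sum fun x _ => hAR x (u x)
  have h2 : ∑ x, u x * (∑ y, a x y * u y - k x (u x)) =
      ∑ x, ∑ y, a x y * u x * u y - ∑ x, u x * k x (u x) := by
    rw [← Finset.sum_sub_distrib]
    refine Finset.sum_congr rfl fun x _ => ?_
    rw [mul_sub, Finset.mul_sum]
    congr 1
    exact Finset.sum_congr rfl fun y _ => by ring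
  rw [← Finset.mul_sum] at h1
  rw [h2, latticeAction]
  linarith

/-- A superlinear variational system on a finite set has a nontrivial solution of mountain pass
type. -/
theorem exists_solution_of_finite_system {a : ι → ι → ℝ} (ha : ∀ x y, a x y = a y x)
    {k : ι → ℝ → ℝ} (hk : ∀ x, Continuous (k x)) {α : ℝ} (hα : 2 < α)
    (hAR : ∀ x y, α * (∫ t in (0 : ℝ)..y, k x t) ≤ y * k x y) {κ : ℝ} (hκ : 0 < κ)
    (hpos : ∀ u : ι → ℝ, κ * ∑ x, u x ^ 2 ≤ ∑ x, ∑ y, a x y * u x * u y) {κ' r₀ : ℝ} (hκ' : 0 < κ')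
    (hr₀ : 0 < r₀)
    (hnear : ∀ u : ι → ℝ, (∀ x, |u x| ≤ r₀) → κ' * ∑ x, u x ^ 2 ≤ latticeAction a k u) {e : ι → ℝ}
    (he : e ≠ 0) (hIe : latticeAction a k e ≤ 0) {c : ℝ}
    (hc : ∀ t ∈ Icc (0 : ℝ) 1, latticeAction a k (t • e) ≤ c) :
    ∃ u : ι → ℝ, u ≠ 0 ∧ (∀ x, ∑ y, a x y * u y = k x (u x)) ∧ latticeAction a k u ≤ c := by
  set e' : EuclideanSpace ℝ ι := WithLp.toLp 2 e with he'
  have he'0 : 0 < ‖e'‖ := by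
    rw [norm_pos_iff]
    intro h
    exact he (by simpa [he'] using h)
  -- On this sphere all coordinates are at most r₀, so `hnear` applies, and e is not inside it.
  set r := min r₀ ‖e'‖ with hr
  have hrpos : 0 < r := lt_min hr₀ he'0
  have hnorm : ∀ u : EuclideanSpace ℝ ι, ∑ x, u x ^ 2 = ‖u‖ ^ 2 := fun u =>
    (EuclideanSpace.real_norm_sq_eq u).symm
  have hcoord : ∀ (u : EuclideanSpace ℝ ι) (x : ι), |u x| ≤ ‖u‖ := fun u x => PiLp.norm_apply_le u x
  set g : EuclideanSpace ℝ ι → EuclideanSpace ℝ ι := fun u =>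
    WithLp.toLp 2 fun x => ∑ y, a x y * u y - k x (u x) with hg
  have hgc : Continuous g := by
    refine (PiLp.continuous_toLp 2 _).comp (continuous_pi fun x => ?_)
    have := hk x
    fun_prop
  have hinner : ∀ u : EuclideanSpace ℝ ι,
      ∑ x, u x * (∑ y, a x y * u y - k x (u x)) = inner ℝ u (g u) := by
    intro u
    simp [PiLp.inner_apply, hg, mul_comm]
  set β := (α / 2 - 1) * κ with hβ
  have hβpos : 0 < β := mul_pos (by linarith) hκ
  -- An almost critical u satisfies β‖u‖² ≤ |αc| + ‖u‖, which is impossible once ‖u‖ exceeds both 1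
  -- and (|αc| + 1)/β; hence the value of `R`.
  obtain ⟨u, hu1, hu2, hu3⟩ := exists_critical_point_of_mountain_pass
    (I := fun u : EuclideanSpace ℝ ι => latticeAction a k u) (g := g) (e := e') (r := r)
    (ρ := κ' * r ^ 2) (c := c) (R := (|α * c| + 1) / β + 1) (hasFDerivAt_latticeAction ha hk) hgc
    (by simp [latticeAction]) (by simpa [he'] using hIe) hrpos.le (min_le_right _ _) (by positivity)
    (fun u hu => by
      rw [← hu, ← hnorm]
      exact hnear u fun x => (hcoord u x).trans (hu ▸ min_le_left _ _))
    (fun t ht => by simpa [he'] using hc t ht)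
    (fun u hu hgu => by
      have h1 := energy_le_latticeAction (a := a) hAR u
      rw [hinner] at h1
      have h2 := hpos u
      rw [hnorm] at h2
      have h3 : (α / 2 - 1) * (κ * ‖u‖ ^ 2) ≤ (α / 2 - 1) * ∑ x, ∑ y, a x y * u x * u y :=
        mul_le_mul_of_nonneg_left h2 (by linarith)
      have h4 : -‖u‖ ≤ inner ℝ u (g u) := by
        have := neg_le_of_abs_le (abs_real_inner_le_norm u (g u))
        nlinarith [norm_nonneg u]
      have h5 : α * latticeAction a k u ≤ α * c := mul_le_mul_of_nonneg_left hu (by linarith)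
      have h6 : β * ‖u‖ ^ 2 ≤ |α * c| + ‖u‖ := by
        rw [hβ]
        linarith [le_abs_self (α * c)]
      by_contra! hcon
      have h7 : 0 ≤ (|α * c| + 1) / β := by positivity
      have h8 : (|α * c| + 1) / β < ‖u‖ := by linarith
      rw [div_lt_iff₀ hβpos] at h8
      nlinarith [abs_nonneg (α * c), norm_nonneg u])
  refine ⟨u, ?_, fun x => ?_, hu2⟩
  · intro h0
    have : latticeAction a k u = 0 := by simp [h0, latticeAction]
    rw [this] at hu1
    have : 0 < κ' * r ^ 2 := by positivity
    linarith
  · have := congrArg (fun v : EuclideanSpace ℝ ι => v x) hu3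
    simpa [hg, sub_eq_zero] using this

end FiniteSystem

/-! ### Entrywise bounds for exponentials of matrices with nonnegative off-diagonal entries -/

section MatrixExponential

theorem Matrix.smul_shift_apply_nonneg {n : Type*} [DecidableEq n] {A : Matrix n n ℝ} (hA : ∀ x y,
    x ≠ y → 0 ≤ A x y) {c t : ℝ}
    (hc : ∀ x, -A x x ≤ c) (ht : 0 ≤ t) (x y : n) :
    0 ≤ (t • (A + c • (1 : Matrix n n ℝ))) x y := by
  rw [Matrix.smul_apply, smul_eq_mul]
  refine mul_nonneg ht ?_
  rw [Matrix.add_apply, Matrix.smul_apply, Matrix.one_apply]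
  split_ifs with h
  · subst h
    have := hc x
    simp only [smul_eq_mul, mul_one]
    linarith
  · simpa using hA x y h

variable {n : Type*} [Fintype n] [DecidableEq n]

theorem Matrix.hasSum_exp_apply (T : Matrix n n ℝ) (x y : n) :
    HasSum (fun k : ℕ => (k.factorial : ℝ)⁻¹ * (T ^ k) x y) (NormedSpace.exp T x y) := by
  let _ : SeminormedRing (Matrix n n ℝ) := Matrix.linftyOpSemiNormedRing
  let _ : NormedRing (Matrix n n ℝ) := Matrix.linftyOpNormedRing
  let _ : NormedAlgebra ℝ (Matrix n n ℝ) := Matrix.linftyOpNormedAlgebra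
  have h := NormedSpace.exp_series_hasSum_exp' (𝕂 := ℝ) T
  exact Pi.hasSum.1 (Pi.hasSum.1 h x) y

theorem Matrix.one_add_apply_le_exp_apply {T : Matrix n n ℝ} (hT : ∀ x y, 0 ≤ T x y) (x y : n) :
    (1 + T) x y ≤ NormedSpace.exp T x y := by
  have h := sum_le_hasSum (Finset.range 2) (fun k _ => mul_nonneg (by positivity)
    (Matrix.pow_apply_nonneg hT k x y)) (Matrix.hasSum_exp_apply T x y)
  simpa [Finset.sum_range_succ] using h

theorem Matrix.sum_exp_apply_le {T : Matrix n n ℝ} (hT : ∀ x y, 0 ≤ T x y) {τ : ℝ} (hτ : 0 ≤ τ)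
    (hrow : ∀ x, ∑ y, T x y ≤ τ) (x : n) : ∑ y, NormedSpace.exp T x y ≤ Real.exp τ := by
  have hpow : ∀ (k : ℕ) (x : n), ∑ y, (T ^ k) x y ≤ τ ^ k := by
    intro k
    induction k with
    | zero => intro x; simp [Matrix.one_apply]
    | succ k ih =>
      intro x
      simp only [pow_succ', Matrix.mul_apply]
      rw [Finset.sum_comm]
      simp only [← Finset.mul_sum]
      calc ∑ z, T x z * ∑ y, (T ^ k) z y ≤ ∑ z, T x z * τ ^ k :=
            Finset.sum_le_sum fun z _ => mul_le_mul_of_nonneg_left (ih z) (hT x z)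
        _ = (∑ z, T x z) * τ ^ k := by rw [Finset.sum_mul]
        _ ≤ τ * τ ^ k := mul_le_mul_of_nonneg_right (hrow x) (by positivity)
  have h1 := hasSum_sum fun y (_ : y ∈ Finset.univ) => Matrix.hasSum_exp_apply T x y
  have h2 := NormedSpace.exp_series_hasSum_exp' (𝕂 := ℝ) τ
  rw [← Real.exp_eq_exp_ℝ] at h2
  refine hasSum_le (fun k => ?_) h1 h2
  rw [← Finset.mul_sum, smul_eq_mul]
  exact mul_le_mul_of_nonneg_left (hpow k x) (by positivity)

/-- For c large the shifted matrix is entrywise nonnegative, so its exponential series has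
nonnegative terms and can be bounded term by term; the scalar shift costs only a factor e^{-ct}. -/
theorem Matrix.exp_smul_eq_shift (A : Matrix n n ℝ) (c t : ℝ) :
    NormedSpace.exp (t • A) =
      Real.exp (-(c * t)) • NormedSpace.exp (t • (A + c • (1 : Matrix n n ℝ))) := by
  have h1 : t • A = (-(c * t)) • (1 : Matrix n n ℝ) + t • (A + c • (1 : Matrix n n ℝ)) := by
    rw [smul_add, smul_smul, neg_smul, mul_comm c t]
    abel
  have hcomm : Commute ((-(c * t)) • (1 : Matrix n n ℝ)) (t • (A + c • (1 : Matrix n n ℝ))) :=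
    (Commute.one_left _).smul_left _
  conv_lhs => rw [h1]
  rw [Matrix.exp_add_of_commute _ _ hcomm, Matrix.smul_one_eq_diagonal, Matrix.exp_diagonal]
  have h2 : (NormedSpace.exp fun _ : n => -(c * t)) = fun _ : n => Real.exp (-(c * t)) := by
    ext x
    rw [Pi.coe_exp, Real.exp_eq_exp_ℝ]
  rw [h2, ← Matrix.smul_one_eq_diagonal, smul_mul_assoc, one_mul]

theorem Matrix.le_exp_smul_apply {A : Matrix n n ℝ} (hA : ∀ x y, x ≠ y → 0 ≤ A x y) {c t : ℝ}
    (hc : ∀ x, -A x x ≤ c) (ht : 0 ≤ t) (x y : n) :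
    Real.exp (-(c * t)) * (1 + t • (A + c • (1 : Matrix n n ℝ))) x y ≤
      NormedSpace.exp (t • A) x y := by
  rw [Matrix.exp_smul_eq_shift A c t, Matrix.smul_apply, smul_eq_mul]
  exact mul_le_mul_of_nonneg_left (Matrix.one_add_apply_le_exp_apply
    (Matrix.smul_shift_apply_nonneg hA hc ht) x y) (Real.exp_pos _).le

theorem Matrix.exp_smul_apply_nonneg {A : Matrix n n ℝ} (hA : ∀ x y, x ≠ y → 0 ≤ A x y) {c t : ℝ}
    (hc : ∀ x, -A x x ≤ c) (ht : 0 ≤ t) (x y : n) : 0 ≤ NormedSpace.exp (t • A) x y := by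
  refine le_trans (mul_nonneg (Real.exp_pos _).le ?_) (Matrix.le_exp_smul_apply hA hc ht x y)
  rw [Matrix.add_apply]
  refine add_nonneg ?_ (Matrix.smul_shift_apply_nonneg hA hc ht x y)
  rw [Matrix.one_apply]
  split_ifs <;> norm_num

theorem Matrix.exp_smul_apply_le_one {A : Matrix n n ℝ} (hA : ∀ x y, x ≠ y → 0 ≤ A x y) {c t : ℝ}
    (hc : ∀ x, -A x x ≤ c) (ht : 0 ≤ t) (hc0 : 0 ≤ c) (hrow : ∀ x, ∑ y, A x y ≤ 0) (x y : n) :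
    NormedSpace.exp (t • A) x y ≤ 1 := by
  have h1 : ∀ x, ∑ y, (t • (A + c • (1 : Matrix n n ℝ))) x y ≤ c * t := by
    intro x
    simp only [Matrix.smul_apply, Matrix.add_apply, smul_eq_mul, ← Finset.mul_sum,
      Finset.sum_add_distrib, Matrix.one_apply]
    have h2 := mul_le_mul_of_nonneg_left (hrow x) ht
    simp only [Finset.sum_ite_eq, Finset.mem_univ, if_true]
    linarith
  have h2 := Matrix.sum_exp_apply_le (Matrix.smul_shift_apply_nonneg hA hc ht)
    (mul_nonneg hc0 ht) h1 x
  have h3 : ∑ y, NormedSpace.exp (t • A) x y ≤ 1 := by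
    rw [Matrix.exp_smul_eq_shift A c t]
    simp only [Matrix.smul_apply, smul_eq_mul, ← Finset.mul_sum]
    calc _ ≤ Real.exp (-(c * t)) * Real.exp (c * t) :=
          mul_le_mul_of_nonneg_left h2 (Real.exp_pos _).le
      _ = 1 := by rw [← Real.exp_add]; simp
  exact (Finset.single_le_sum (fun z _ => Matrix.exp_smul_apply_nonneg hA hc ht x z)
    (Finset.mem_univ y)).trans h3

end MatrixExponential

/-- Symmetry with respect to the weights m passes to powers, hence to the exponential series. -/
theorem Matrix.mul_exp_apply_symm {n : Type*} [Fintype n] [DecidableEq n] {A : Matrix n n ℝ}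
    {m : n → ℝ} (hA : ∀ x y, m x * A x y = m y * A y x) (t : ℝ) (x y : n) :
    m x * NormedSpace.exp (t • A) x y = m y * NormedSpace.exp (t • A) y x := by
  have hpow : ∀ (k : ℕ) (x y : n), m x * (A ^ k) x y = m y * (A ^ k) y x := by
    intro k
    induction k with
    | zero =>
      intro x y
      by_cases h : x = y
      · rw [h]
      · simp [h, Ne.symm h]
    | succ k ih =>
      intro x y
      rw [pow_succ, Matrix.mul_apply, ← pow_succ, pow_succ', Matrix.mul_apply, Finset.mul_sum,
        Finset.mul_sum]
      refine Finset.sum_congr rfl fun z _ => ?_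
      rw [← mul_assoc, ih, mul_right_comm, hA z y]
      ring
  refine HasSum.unique ((Matrix.hasSum_exp_apply _ x y).mul_left (m x)) ?_
  convert (Matrix.hasSum_exp_apply (t • A) y x).mul_left (m y) using 2 with k
  have := hpow k x y
  simp only [smul_pow, Matrix.smul_apply, smul_eq_mul]
  linear_combination ((k.factorial : ℝ)⁻¹ * t ^ k) * this

/-! ### Heat kernel bounds and summability of the fractional kernel -/

namespace WeightedGraph

variable {V : Type*} (G : WeightedGraph V) [G.graph.LocallyFinite]

/-- The weighted degree `μ(x)⁻¹ ∑_{y ∼ x} w_{xy}`. -/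
noncomputable def weightedDegree (x : V) : ℝ :=
  (1 / G.μ x) * ∑ y ∈ G.graph.neighborFinset x, G.w x y

theorem weightedDegree_nonneg (x : V) : 0 ≤ G.weightedDegree x :=
  mul_nonneg (one_div_nonneg.2 (G.μ_pos x).le) (Finset.sum_nonneg fun y hy =>
    (G.w_pos x y (by simpa using hy)).le)

open Classical in
theorem dirichletLaplacian_apply_of_ne {D : Finset V} {x y : D} (h : x ≠ y) :
    G.dirichletLaplacian D x y = (1 / G.μ x) * if G.graph.Adj x y then G.w x y else 0 := by
  have h' : (x : V) ≠ y := fun e => h (Subtype.ext e)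
  simp only [dirichletLaplacian, laplacian, Matrix.of_apply, Pi.single_apply, h', if_false,
    sub_zero, mul_ite, mul_one, mul_zero]
  rw [Finset.sum_ite_eq']
  simp

open Classical in
theorem dirichletLaplacian_apply_self {D : Finset V} (x : D) :
    G.dirichletLaplacian D x x = -G.weightedDegree x := by
  simp only [dirichletLaplacian, laplacian, weightedDegree, Matrix.of_apply]
  rw [← mul_neg, ← Finset.sum_neg_distrib]
  congr 1
  refine Finset.sum_congr rfl fun z hz => ?_
  have : z ≠ x := by
    have h := (G.graph.mem_neighborFinset x z).1 hz
    exact h.ne'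
  simp [this]

theorem dirichletLaplacian_offDiag_nonneg {D : Finset V} (x y : D) (h : x ≠ y) :
    0 ≤ G.dirichletLaplacian D x y := by
  classical
  rw [dirichletLaplacian_apply_of_ne G h]
  refine mul_nonneg (one_div_nonneg.2 (G.μ_pos x).le) ?_
  split_ifs with hxy
  · exact (G.w_pos _ _ hxy).le
  · exact le_rfl

theorem sum_dirichletLaplacian_nonpos {D : Finset V} (x : D) :
    ∑ y, G.dirichletLaplacian D x y ≤ 0 := by
  classical
  simp only [dirichletLaplacian, laplacian, Matrix.of_apply]
  rw [← Finset.mul_sum, Finset.sum_comm]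
  refine mul_nonpos_of_nonneg_of_nonpos (one_div_nonneg.2 (G.μ_pos x).le)
    (Finset.sum_nonpos fun z hz => ?_)
  rw [← Finset.mul_sum, Finset.sum_sub_distrib]
  refine mul_nonpos_of_nonneg_of_nonpos (G.w_pos x z (by simpa using hz)).le ?_
  have h1 : ∑ y : D, (Pi.single (y : V) (1 : ℝ) : V → ℝ) x = 1 := by
    rw [Finset.sum_eq_single x (fun y _ hy => ?_) (by simp), Pi.single_eq_same]
    exact Pi.single_eq_of_ne (fun e => hy (Subtype.ext e.symm)) _
  have h2 : ∑ y : D, (Pi.single (y : V) (1 : ℝ) : V → ℝ) z ≤ 1 := by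
    rw [Finset.sum_coe_sort D fun y => (Pi.single y (1 : ℝ) : V → ℝ) z]
    simp only [Pi.single_apply, Finset.sum_ite_eq]
    split_ifs <;> norm_num
  linarith

theorem dirichletLaplacian_symm {D : Finset V} (x y : D) :
    G.μ x * G.dirichletLaplacian D x y = G.μ y * G.dirichletLaplacian D y x := by
  classical
  by_cases h : x = y
  · rw [h]
  · rw [dirichletLaplacian_apply_of_ne G h, dirichletLaplacian_apply_of_ne G (Ne.symm h),
      ← mul_assoc, ← mul_assoc, mul_one_div_cancel (G.μ_pos x).ne',
      mul_one_div_cancel (G.μ_pos y).ne', G.graph.adj_comm]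
    split_ifs with hxy
    · rw [G.w_symm _ _ hxy]
    · rfl

theorem neg_dirichletLaplacian_self_le {D : Finset V} (x : D) :
    -G.dirichletLaplacian D x x ≤ ∑ z ∈ D, G.weightedDegree z := by
  rw [dirichletLaplacian_apply_self, neg_neg]
  exact Finset.single_le_sum (fun z _ => G.weightedDegree_nonneg z) x.2

variable {t : ℝ}

theorem dirichletHeatKernel_nonneg (D : Finset V) (ht : 0 ≤ t) (x y : V) :
    0 ≤ G.dirichletHeatKernel D t x y := by
  classical
  rw [dirichletHeatKernel]
  split_ifs with h
  · exact div_nonneg (Matrix.exp_smul_apply_nonneg G.dirichletLaplacian_offDiag_nonneg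
      G.neg_dirichletLaplacian_self_le ht _ _) (G.μ_pos y).le
  · exact le_rfl

theorem dirichletHeatKernel_le (D : Finset V) (ht : 0 ≤ t) (x y : V) :
    G.dirichletHeatKernel D t x y ≤ 1 / G.μ y := by
  classical
  rw [dirichletHeatKernel]
  split_ifs with h
  · exact div_le_div_of_nonneg_right (Matrix.exp_smul_apply_le_one
      G.dirichletLaplacian_offDiag_nonneg G.neg_dirichletLaplacian_self_le ht
      (Finset.sum_nonneg fun z _ => G.weightedDegree_nonneg z)
      G.sum_dirichletLaplacian_nonpos _ _) (G.μ_pos y).le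
  · exact one_div_nonneg.2 (G.μ_pos y).le

theorem dirichletHeatKernel_symm (D : Finset V) (t : ℝ) (x y : V) :
    G.dirichletHeatKernel D t x y = G.dirichletHeatKernel D t y x := by
  classical
  rw [dirichletHeatKernel, dirichletHeatKernel]
  by_cases h : x ∈ D ∧ y ∈ D
  · rw [dif_pos h, dif_pos h.symm, div_eq_div_iff (G.μ_pos y).ne' (G.μ_pos x).ne', mul_comm,
      mul_comm _ (G.μ y)]
    exact Matrix.mul_exp_apply_symm (m := fun z : D => G.μ z) G.dirichletLaplacian_symm t
      ⟨x, h.1⟩ ⟨y, h.2⟩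
  · rw [dif_neg h, dif_neg fun h' => h h'.symm]

theorem continuous_dirichletHeatKernel (D : Finset V) (x y : V) :
    Continuous fun t => G.dirichletHeatKernel D t x y := by
  classical
  by_cases h : x ∈ D ∧ y ∈ D
  · simp only [dirichletHeatKernel, dif_pos h]
    refine Continuous.div_const ?_ _
    let _ : SeminormedRing (Matrix D D ℝ) := Matrix.linftyOpSemiNormedRing
    let _ : NormedRing (Matrix D D ℝ) := Matrix.linftyOpNormedRing
    let _ : NormedAlgebra ℝ (Matrix D D ℝ) := Matrix.linftyOpNormedAlgebra
    let _ : NormedAlgebra ℚ (Matrix D D ℝ) := NormedAlgebra.restrictScalars ℚ ℝ _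
    have h1 : Continuous fun t : ℝ => NormedSpace.exp (t • G.dirichletLaplacian D) :=
      NormedSpace.exp_continuous.comp (continuous_id.smul continuous_const)
    exact (continuous_apply _).comp ((continuous_apply _).comp h1)
  · simp only [dirichletHeatKernel, dif_neg h]
    exact continuous_const

theorem bddAbove_dirichletHeatKernel (ht : 0 ≤ t) (x y : V) :
    BddAbove (range fun D => G.dirichletHeatKernel D t x y) :=
  ⟨1 / G.μ y, by rintro _ ⟨D, rfl⟩; exact G.dirichletHeatKernel_le D ht x y⟩

theorem dirichletHeatKernel_le_heatKernel (D : Finset V) (ht : 0 ≤ t) (x y : V) :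
    G.dirichletHeatKernel D t x y ≤ G.heatKernel t x y :=
  le_ciSup (G.bddAbove_dirichletHeatKernel ht x y) D

theorem heatKernel_nonneg (ht : 0 ≤ t) (x y : V) : 0 ≤ G.heatKernel t x y :=
  (G.dirichletHeatKernel_nonneg ∅ ht x y).trans (G.dirichletHeatKernel_le_heatKernel ∅ ht x y)

theorem heatKernel_symm (t : ℝ) (x y : V) : G.heatKernel t x y = G.heatKernel t y x :=
  iSup_congr fun D => G.dirichletHeatKernel_symm D t x y

open Classical in
theorem le_heatKernel {D : Finset V} {x y : V} (hx : x ∈ D) (hy : y ∈ D) {c : ℝ}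
    (hc : ∀ z ∈ D, G.weightedDegree z ≤ c) (ht : 0 ≤ t) :
    Real.exp (-(c * t)) * (1 + t • (G.dirichletLaplacian D + c • (1 : Matrix D D ℝ))) ⟨x, hx⟩
      ⟨y, hy⟩ / G.μ y ≤ G.heatKernel t x y := by
  refine le_trans ?_ (G.dirichletHeatKernel_le_heatKernel D ht x y)
  rw [dirichletHeatKernel, dif_pos ⟨hx, hy⟩]
  refine div_le_div_of_nonneg_right ?_ (G.μ_pos y).le
  refine Matrix.le_exp_smul_apply G.dirichletLaplacian_offDiag_nonneg (fun z => ?_) ht _ _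
  rw [dirichletLaplacian_apply_self, neg_neg]
  exact hc z z.2

/-- Comparison with D = {x}, where the Dirichlet kernel is e^{-ct}/μ(x) for c the weighted degree,
and e^{-ct} ≥ 1 - ct. -/
theorem one_sub_le_heatKernel_self (ht : 0 ≤ t) (x : V) :
    1 - G.weightedDegree x * t ≤ G.heatKernel t x x * G.μ x := by
  classical
  have h := G.le_heatKernel (Finset.mem_singleton_self x) (Finset.mem_singleton_self x)
    (c := G.weightedDegree x) (fun z hz => by rw [Finset.mem_singleton.1 hz]) ht
  rw [div_le_iff₀ (G.μ_pos x)] at h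
  refine le_trans ?_ h
  simp only [Matrix.add_apply, Matrix.smul_apply, Matrix.one_apply_eq,
    dirichletLaplacian_apply_self, smul_eq_mul, mul_one, neg_add_cancel, mul_zero, add_zero]
  linarith [Real.add_one_le_exp (-(G.weightedDegree x * t))]

/-- On D = {x, y} the linear term of the exponential series is already positive. -/
theorem heatKernel_pos_of_adj (ht : 0 < t) {x y : V} (h : G.graph.Adj x y) :
    0 < G.heatKernel t x y := by
  classical
  have hle := G.le_heatKernel (D := {x, y}) (x := x) (y := y) (by simp) (by simp)
    (c := G.weightedDegree x + G.weightedDegree y) (fun z hz => by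
      have h1 := G.weightedDegree_nonneg x
      have h2 := G.weightedDegree_nonneg y
      rcases Finset.mem_insert.1 hz with rfl | hz
      · linarith
      · rw [Finset.mem_singleton.1 hz]
        linarith) ht.le
  refine lt_of_lt_of_le (div_pos (mul_pos (Real.exp_pos _) ?_) (G.μ_pos y)) hle
  have hne : (⟨x, by simp⟩ : ({x, y} : Finset V)) ≠ ⟨y, by simp⟩ := fun e =>
    h.ne (Subtype.ext_iff.1 e)
  simp only [Matrix.add_apply, Matrix.smul_apply, Matrix.one_apply_ne hne, zero_add, smul_eq_mul,
    mul_zero, add_zero]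
  rw [dirichletLaplacian_apply_of_ne G hne, if_pos h]
  exact mul_pos ht (mul_pos (one_div_pos.2 (G.μ_pos x)) (G.w_pos x y h))

theorem aestronglyMeasurable_heatKernel (x y : V) :
    AEStronglyMeasurable (fun t => G.heatKernel t x y) (volume.restrict (Ioi 0)) := by
  -- A supremum of continuous functions is lower semicontinuous over any index set, so no
  -- countability of V is needed. Replacing t by max(t, 0) keeps the suprema bounded.
  have h1 : LowerSemicontinuous fun t : ℝ => ⨆ D, G.dirichletHeatKernel D (max t 0) x y :=
    lowerSemicontinuous_ciSup (fun t => G.bddAbove_dirichletHeatKernel (le_max_right t 0) x y)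
      fun D => ((G.continuous_dirichletHeatKernel D x y).comp
        (continuous_id.max continuous_const)).lowerSemicontinuous
  refine h1.measurable.aestronglyMeasurable.congr ?_
  filter_upwards [self_mem_ae_restrict measurableSet_Ioi] with t ht
  rw [heatKernel, max_eq_left (le_of_lt ht)]

variable {G}

/-- The total mass is 1 and at least 1 - ct of it remains at x. -/
theorem StochasticallyComplete.sum_heatKernel_le (hG : G.StochasticallyComplete) (ht : 0 < t)
    {x : V} {T : Finset V} (hT : x ∉ T) :
    ∑ y ∈ T, G.heatKernel t x y * G.μ y ≤ min 1 (G.weightedDegree x * t) := by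
  classical
  have hnn : ∀ y, 0 ≤ G.heatKernel t x y * G.μ y := fun y =>
    mul_nonneg (G.heatKernel_nonneg ht.le x y) (G.μ_pos y).le
  have h1 := sum_le_hasSum (insert x T) (fun y _ => hnn y) (hG t ht x)
  rw [Finset.sum_insert hT] at h1
  have h2 := G.one_sub_le_heatKernel_self ht.le x
  exact le_min (by linarith [hnn x]) (by linarith)

/-- On (0, 1] the bound ct leaves t^{-s}, integrable as s < 1; on (1, ∞) the bound 1 leaves
t^{-1-s}, integrable as s > 0. -/
theorem integrableOn_min_mul_rpow {s : ℝ} (hs0 : 0 < s) (hs1 : s < 1) (c : ℝ) (hc : 0 ≤ c) :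
    IntegrableOn (fun t : ℝ => min 1 (c * t) * t ^ (-1 - s)) (Ioi 0) := by
  have hmeas : Measurable fun t : ℝ => min 1 (c * t) * t ^ (-1 - s) := by fun_prop
  rw [← Ioc_union_Ioi_eq_Ioi zero_le_one]
  refine IntegrableOn.union ?_ ?_
  · have h1 : IntegrableOn (fun t : ℝ => c * t ^ (-s)) (Ioc 0 1) := by
      refine Integrable.const_mul ?_ c
      exact (intervalIntegrable_iff_integrableOn_Ioc_of_le zero_le_one).1
        (intervalIntegral.intervalIntegrable_rpow' (by linarith))
    refine Integrable.mono' h1 hmeas.aestronglyMeasurable ?_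
    filter_upwards [self_mem_ae_restrict measurableSet_Ioc] with t ht
    have hp : 0 ≤ t ^ (-1 - s) := Real.rpow_nonneg ht.1.le _
    have hm : 0 ≤ min 1 (c * t) := le_min zero_le_one (mul_nonneg hc ht.1.le)
    rw [Real.norm_of_nonneg (mul_nonneg hm hp)]
    calc min 1 (c * t) * t ^ (-1 - s) ≤ c * t * t ^ (-1 - s) :=
          mul_le_mul_of_nonneg_right (min_le_right _ _) hp
      _ = c * t ^ (-s) := by
          rw [mul_assoc, ← Real.rpow_one_add' ht.1.le (by linarith)]
          congr 2
          ring
  · have h1 : IntegrableOn (fun t : ℝ => t ^ (-1 - s)) (Ioi 1) :=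
      integrableOn_Ioi_rpow_of_lt (by linarith) one_pos
    refine Integrable.mono' h1 hmeas.aestronglyMeasurable ?_
    filter_upwards [self_mem_ae_restrict measurableSet_Ioi] with t ht
    have ht0 : 0 < t := zero_lt_one.trans ht
    have hp : 0 ≤ t ^ (-1 - s) := Real.rpow_nonneg ht0.le _
    have hm : 0 ≤ min 1 (c * t) := le_min zero_le_one (mul_nonneg hc ht0.le)
    rw [Real.norm_of_nonneg (mul_nonneg hm hp)]
    exact mul_le_of_le_one_left hp (min_le_left _ _)

variable {s : ℝ}

theorem StochasticallyComplete.integrableOn_heatKernel (hG : G.StochasticallyComplete)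
    (hs0 : 0 < s) (hs1 : s < 1) {x y : V} (hxy : x ≠ y) :
    IntegrableOn (fun t => G.heatKernel t x y * t ^ (-1 - s)) (Ioi 0) := by
  have h1 := (integrableOn_min_mul_rpow hs0 hs1 _ (G.weightedDegree_nonneg x)).const_mul (G.μ y)⁻¹
  refine Integrable.mono' h1 ((G.aestronglyMeasurable_heatKernel x y).mul
    (by fun_prop : Measurable fun t : ℝ => t ^ (-1 - s)).aestronglyMeasurable) ?_
  filter_upwards [self_mem_ae_restrict measurableSet_Ioi] with t ht
  have ht0 : 0 < t := ht
  have hp : 0 ≤ t ^ (-1 - s) := Real.rpow_nonneg ht0.le _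
  rw [Real.norm_of_nonneg (mul_nonneg (G.heatKernel_nonneg ht0.le x y) hp), ← mul_assoc]
  refine mul_le_mul_of_nonneg_right ?_ hp
  have h2 := hG.sum_heatKernel_le ht0 (x := x) (T := {y}) (by simpa using hxy)
  rw [Finset.sum_singleton] at h2
  rw [le_inv_mul_iff₀ (G.μ_pos y), mul_comm]
  exact h2

theorem fracKernel_const_pos (hs0 : 0 < s) (hs1 : s < 1) : 0 < s / Real.Gamma (1 - s) :=
  div_pos hs0 (Real.Gamma_pos_of_pos (by linarith))

variable (G) in
theorem fracKernel_self (s : ℝ) (x : V) : G.fracKernel s x x = 0 := if_pos rfl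

variable (G) in
theorem fracKernel_nonneg (hs0 : 0 < s) (hs1 : s < 1) (x y : V) : 0 ≤ G.fracKernel s x y := by
  rw [fracKernel]
  split_ifs with h
  · exact le_rfl
  · refine mul_nonneg (mul_nonneg (mul_nonneg (fracKernel_const_pos hs0 hs1).le (G.μ_pos x).le)
      (G.μ_pos y).le) (setIntegral_nonneg measurableSet_Ioi fun t ht => ?_)
    exact mul_nonneg (G.heatKernel_nonneg (le_of_lt ht) x y) (Real.rpow_nonneg (le_of_lt ht) _)

variable (G) in
theorem fracKernel_symm (s : ℝ) (x y : V) : G.fracKernel s x y = G.fracKernel s y x := by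
  by_cases h : x = y
  · rw [h]
  · rw [fracKernel, fracKernel, if_neg h, if_neg (Ne.symm h)]
    simp only [G.heatKernel_symm _ x y]
    ring

theorem StochasticallyComplete.fracKernel_pos_of_adj (hG : G.StochasticallyComplete) (hs0 : 0 < s)
    (hs1 : s < 1) {x y : V} (h : G.graph.Adj x y) : 0 < G.fracKernel s x y := by
  rw [fracKernel, if_neg h.ne]
  refine mul_pos (mul_pos (mul_pos (fracKernel_const_pos hs0 hs1) (G.μ_pos x)) (G.μ_pos y)) ?_
  have hpos : ∀ t ∈ Ioi (0 : ℝ), 0 < G.heatKernel t x y * t ^ (-1 - s) := fun t ht =>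
    mul_pos (G.heatKernel_pos_of_adj ht h) (Real.rpow_pos_of_pos ht _)
  rw [setIntegral_pos_iff_support_of_nonneg_ae
    ((ae_restrict_mem measurableSet_Ioi).mono fun t ht => (hpos t ht).le)
    (hG.integrableOn_heatKernel hs0 hs1 h.ne)]
  refine lt_of_lt_of_le ?_ (measure_mono (s := Ioi (0 : ℝ)) fun t ht => ⟨(hpos t ht).ne', ht⟩)
  simp

/-- Finite sums commute with the time integral, and the heat mass on a finite set avoiding x is at
most min(1, ct) at each time. -/
theorem StochasticallyComplete.summable_fracKernel (hG : G.StochasticallyComplete) (hs0 : 0 < s)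
    (hs1 : s < 1) (x : V) : Summable (G.fracKernel s x) := by
  classical
  refine summable_of_sum_le (fun y => G.fracKernel_nonneg hs0 hs1 x y)
    (c := s / Real.Gamma (1 - s) * G.μ x *
      ∫ t in Ioi (0 : ℝ), min 1 (G.weightedDegree x * t) * t ^ (-1 - s)) fun T => ?_
  have h1 : ∑ y ∈ T, G.fracKernel s x y = ∑ y ∈ T.erase x, G.fracKernel s x y := by
    by_cases hx : x ∈ T
    · rw [← Finset.add_sum_erase T _ hx, fracKernel_self, zero_add]
    · rw [Finset.erase_eq_of_notMem hx]
  have h2 : ∀ y ∈ T.erase x, G.fracKernel s x y = s / Real.Gamma (1 - s) * G.μ x *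
      ∫ t in Ioi (0 : ℝ), G.μ y * (G.heatKernel t x y * t ^ (-1 - s)) := by
    intro y hy
    rw [fracKernel, if_neg (Finset.ne_of_mem_erase hy).symm, integral_const_mul]
    ring
  have hint : ∀ y ∈ T.erase x,
      IntegrableOn (fun t => G.μ y * (G.heatKernel t x y * t ^ (-1 - s))) (Ioi 0) := fun y hy =>
    (hG.integrableOn_heatKernel hs0 hs1 (Finset.ne_of_mem_erase hy).symm).const_mul _
  rw [h1, Finset.sum_congr rfl h2, ← Finset.mul_sum, ← integral_finsetSum _ hint]
  refine mul_le_mul_of_nonneg_left ?_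
    (mul_nonneg (fracKernel_const_pos hs0 hs1).le (G.μ_pos x).le)
  refine setIntegral_mono_on (integrable_finsetSum _ hint)
    (integrableOn_min_mul_rpow hs0 hs1 _ (G.weightedDegree_nonneg x)) measurableSet_Ioi
    fun t ht => ?_
  have h3 : ∑ y ∈ T.erase x, G.μ y * (G.heatKernel t x y * t ^ (-1 - s)) =
      (∑ y ∈ T.erase x, G.heatKernel t x y * G.μ y) * t ^ (-1 - s) := by
    rw [Finset.sum_mul]
    exact Finset.sum_congr rfl fun y _ => by ring
  rw [h3]
  exact mul_le_mul_of_nonneg_right (hG.sum_heatKernel_le ht (Finset.notMem_erase x T))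
    (Real.rpow_nonneg (le_of_lt ht) _)

end WeightedGraph

/-! ### Square-summable families and Cauchy–Schwarz -/

section SquareSummable

variable {ι : Type*} {a b : ι → ℝ}

theorem Summable.mul_of_sq (ha : Summable fun i => a i ^ 2) (hb : Summable fun i => b i ^ 2) :
    Summable fun i => a i * b i := by
  refine Summable.of_norm_bounded (ha.add hb) fun i => ?_
  rw [Real.norm_eq_abs, abs_le]
  constructor <;> nlinarith [sq_nonneg (a i + b i), sq_nonneg (a i - b i), sq_nonneg (a i),
    sq_nonneg (b i)]

theorem Summable.sub_sq (ha : Summable fun i => a i ^ 2) (hb : Summable fun i => b i ^ 2) :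
    Summable fun i => (a i - b i) ^ 2 := by
  have h := (ha.sub ((ha.mul_of_sq hb).mul_left 2)).add hb
  exact h.congr fun i => by ring

theorem tsum_sub_sq (ha : Summable fun i => a i ^ 2) (hb : Summable fun i => b i ^ 2) :
    ∑' i, (a i - b i) ^ 2 = ∑' i, a i ^ 2 - 2 * ∑' i, a i * b i + ∑' i, b i ^ 2 := by
  have hab := (ha.mul_of_sq hb).mul_left 2
  rw [← tsum_mul_left, ← ha.tsum_sub hab, ← (ha.sub hab).tsum_add hb]
  exact tsum_congr fun i => by ring

theorem sq_tsum_mul_le (ha : Summable fun i => a i ^ 2) (hb : Summable fun i => b i ^ 2) :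
    (∑' i, a i * b i) ^ 2 ≤ (∑' i, a i ^ 2) * ∑' i, b i ^ 2 := by
  have h : ∀ t : ℝ, 0 ≤ (∑' i, b i ^ 2) * (t * t) + (-2 * ∑' i, a i * b i) * t + ∑' i, a i ^ 2 := by
    intro t
    have hb' : Summable fun i => (t * b i) ^ 2 := (hb.mul_left (t ^ 2)).congr fun i => by ring
    have h1 : 0 ≤ ∑' i, (a i - t * b i) ^ 2 := tsum_nonneg fun i => sq_nonneg _
    rw [tsum_sub_sq ha hb'] at h1
    have h2 : ∑' i, a i * (t * b i) = t * ∑' i, a i * b i := by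
      rw [← tsum_mul_left]
      exact tsum_congr fun i => by ring
    have h3 : ∑' i, (t * b i) ^ 2 = t ^ 2 * ∑' i, b i ^ 2 := by
      rw [← tsum_mul_left]
      exact tsum_congr fun i => by ring
    rw [h2, h3] at h1
    linarith
  have := discrim_le_zero h
  rw [discrim] at this
  linarith

theorem tendsto_tsum_mul_of_tendsto_tsum_sq {β : Type*} {l : Filter β} {a : β → ι → ℝ}
    (ha : ∀ n, Summable fun i => a n i ^ 2) (hb : Summable fun i => b i ^ 2)
    (h0 : Tendsto (fun n => ∑' i, a n i ^ 2) l (𝓝 0)) :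
    Tendsto (fun n => ∑' i, a n i * b i) l (𝓝 0) := by
  have h1 : Tendsto (fun n => √((∑' i, a n i ^ 2) * ∑' i, b i ^ 2)) l (𝓝 0) := by
    have := (h0.mul_const (∑' i, b i ^ 2)).sqrt
    simpa using this
  exact squeeze_zero_norm (fun n => Real.abs_le_sqrt (sq_tsum_mul_le (ha n) hb)) h1

end SquareSummable

/-! ### The energy as a squared ℓ² norm on V × V, and summation by parts -/

namespace WeightedGraph

variable {V : Type*} (G : WeightedGraph V) [G.graph.LocallyFinite]

open Classical in
/-- The square-summable family on `V × V` that represents `u` isometrically: on the diagonal it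
carries the potential part of the energy, off the diagonal the jumps of `u`. -/
noncomputable def energyVec (s : ℝ) (h u : V → ℝ) (p : V × V) : ℝ :=
  if p.1 = p.2 then √(h p.1 * G.μ p.1) * u p.1
  else √(G.fracKernel s p.1 p.2 / 2) * (u p.1 - u p.2)

/-- The operator `μ ((-Δ)^s + h)`. -/
noncomputable def schrodinger (s : ℝ) (h u : V → ℝ) (x : V) : ℝ :=
  ∑' y, G.fracKernel s x y * (u x - u y) + h x * G.μ x * u x

theorem energyVec_sub (s : ℝ) (h u v : V → ℝ) (p : V × V) :
    G.energyVec s h (fun x => u x - v x) p = G.energyVec s h u p - G.energyVec s h v p := by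
  simp only [energyVec]
  split_ifs <;> ring

variable {G} {s : ℝ} {h u v : V → ℝ}

open Classical in
theorem energyVec_mul_energyVec (hs0 : 0 < s) (hs1 : s < 1) (hh : ∀ x, 0 ≤ h x) (u v : V → ℝ)
    (x y : V) : G.energyVec s h u (x, y) * G.energyVec s h v (x, y) =
      (if y = x then h x * G.μ x * u x * v x else 0) +
        1 / 2 * (G.fracKernel s x y * (u x - u y) * (v x - v y)) := by
  simp only [energyVec]
  by_cases hxy : x = y
  · subst hxy
    have : √(h x * G.μ x) * √(h x * G.μ x) = h x * G.μ x :=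
      Real.mul_self_sqrt (mul_nonneg (hh x) (G.μ_pos x).le)
    simp only [if_true, fracKernel_self, zero_mul, mul_zero, add_zero]
    linear_combination (u x * v x) * this
  · have : √(G.fracKernel s x y / 2) * √(G.fracKernel s x y / 2) = G.fracKernel s x y / 2 :=
      Real.mul_self_sqrt (div_nonneg (G.fracKernel_nonneg hs0 hs1 x y) zero_le_two)
    rw [if_neg hxy, if_neg hxy, if_neg (Ne.symm hxy)]
    linear_combination ((u x - u y) * (v x - v y)) * this

theorem StochasticallyComplete.summable_fracKernel_mul (hG : G.StochasticallyComplete)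
    (hs0 : 0 < s) (hs1 : s < 1) (x : V) {k : V → ℝ} {C : ℝ} (hk : ∀ y, |k y| ≤ C) :
    Summable fun y => G.fracKernel s x y * k y := by
  refine Summable.of_norm_bounded ((hG.summable_fracKernel hs0 hs1 x).mul_right C) fun y => ?_
  rw [norm_mul, Real.norm_of_nonneg (G.fracKernel_nonneg hs0 hs1 x y)]
  exact mul_le_mul_of_nonneg_left (hk y) (G.fracKernel_nonneg hs0 hs1 x y)

theorem abs_sub_le_two_mul {C : ℝ} (hu : ∀ x, |u x| ≤ C) (x y : V) : |u x - u y| ≤ 2 * C :=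
  (abs_sub (u x) (u y)).trans (by linarith [hu x, hu y])

theorem StochasticallyComplete.hasSum_energyVec_row (hG : G.StochasticallyComplete)
    (hs0 : 0 < s) (hs1 : s < 1) (hh : ∀ x, 0 ≤ h x) (hu : ∃ C, ∀ x, |u x| ≤ C)
    (hv : ∃ C, ∀ x, |v x| ≤ C) (x : V) :
    HasSum (fun y => G.energyVec s h u (x, y) * G.energyVec s h v (x, y))
      ((G.gradInner s u v x + h x * u x * v x) * G.μ x) := by
  classical
  obtain ⟨C, hC⟩ := hu
  obtain ⟨C', hC'⟩ := hv
  have h1 : Summable fun y => G.fracKernel s x y * ((u x - u y) * (v x - v y)) := by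
    refine hG.summable_fracKernel_mul hs0 hs1 x (C := 2 * C * (2 * C')) fun y => ?_
    rw [abs_mul]
    exact mul_le_mul (abs_sub_le_two_mul hC x y) (abs_sub_le_two_mul hC' x y) (abs_nonneg _)
      ((abs_nonneg _).trans (abs_sub_le_two_mul hC x x))
  simp only [← mul_assoc] at h1
  have h2 := (hasSum_ite_eq x (h x * G.μ x * u x * v x)).add (h1.hasSum.mul_left (1 / 2))
  simp only [energyVec_mul_energyVec hs0 hs1 hh]
  convert h2 using 1
  rw [gradInner]
  have := (G.μ_pos x).ne'
  field_simp
  ring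

theorem StochasticallyComplete.hasSum_energy (hG : G.StochasticallyComplete)
    (hs0 : 0 < s) (hs1 : s < 1) (hh : ∀ x, 0 ≤ h x) (hu : ∃ C, ∀ x, |u x| ≤ C)
    (hv : ∃ C, ∀ x, |v x| ≤ C)
    (huv : Summable fun p => G.energyVec s h u p * G.energyVec s h v p) :
    HasSum (fun x => (G.gradInner s u v x + h x * u x * v x) * G.μ x)
      (∑' p, G.energyVec s h u p * G.energyVec s h v p) :=
  huv.hasSum.prod_fiberwise fun x => hG.hasSum_energyVec_row hs0 hs1 hh hu hv x

theorem gradInner_add_sq_eq (u : V → ℝ) (x : V) : G.gradInner s u u x + h x * u x ^ 2 =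
    G.gradInner s u u x + h x * u x * u x := by ring

/-- All terms are nonnegative, so summing over V × V is summing the rows first; the row sums are the
energy densities times μ. -/
theorem StochasticallyComplete.isIntegrable_energy_iff (hG : G.StochasticallyComplete)
    (hs0 : 0 < s) (hs1 : s < 1) (hh : ∀ x, 0 ≤ h x) (hu : ∃ C, ∀ x, |u x| ≤ C) :
    G.IsIntegrable (fun x => G.gradInner s u u x + h x * u x ^ 2) ↔
      Summable fun p => G.energyVec s h u p ^ 2 := by
  simp only [IsIntegrable, gradInner_add_sq_eq]
  constructor
  · intro hsum
    rw [summable_prod_of_nonneg fun p => sq_nonneg _]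
    have hrow := fun x => hG.hasSum_energyVec_row hs0 hs1 hh hu hu x
    simp only [← sq] at hrow
    exact ⟨fun x => (hrow x).summable, hsum.congr fun x => (hrow x).tsum_eq.symm⟩
  · intro hsum
    simp only [sq] at hsum
    exact (hG.hasSum_energy hs0 hs1 hh hu hu hsum).summable

theorem StochasticallyComplete.hsNorm_sq (hG : G.StochasticallyComplete)
    (hs0 : 0 < s) (hs1 : s < 1) (hh : ∀ x, 0 ≤ h x) (hu : ∃ C, ∀ x, |u x| ≤ C)
    (hsum : Summable fun p => G.energyVec s h u p ^ 2) :
    G.hsNorm s h u ^ 2 = ∑' p, G.energyVec s h u p ^ 2 := by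
  have h1 : G.integral (fun x => G.gradInner s u u x + h x * u x ^ 2) =
      ∑' p, G.energyVec s h u p ^ 2 := by
    simp only [integral, gradInner_add_sq_eq]
    simp only [sq] at hsum ⊢
    exact (hG.hasSum_energy hs0 hs1 hh hu hu hsum).tsum_eq
  rw [hsNorm, h1, Real.sq_sqrt (tsum_nonneg fun p => sq_nonneg _)]

theorem exists_abs_le_of_finite_support {φ : V → ℝ} (hφ : (Function.support φ).Finite) :
    ∃ C, ∀ x, |φ x| ≤ C := by
  refine ⟨∑ y ∈ hφ.toFinset, |φ y|, fun x => ?_⟩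
  by_cases hx : φ x = 0
  · rw [hx, abs_zero]
    exact Finset.sum_nonneg fun y _ => abs_nonneg _
  · exact Finset.single_le_sum (f := fun y => |φ y|) (fun y _ => abs_nonneg _) (by simpa using hx)

/-- One half of the summation by parts: only the φ(x) in the jump φ(x) - φ(y) is kept. Finite
support of φ leaves finitely many rows, each convergent because u is bounded. -/
theorem StochasticallyComplete.hasSum_half_jump_mul (hG : G.StochasticallyComplete)
    (hs0 : 0 < s) (hs1 : s < 1) {φ : V → ℝ} {S : Finset V} (hφ : ∀ x, x ∉ S → φ x = 0)
    (hu : ∃ C, ∀ x, |u x| ≤ C) :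
    HasSum (fun p : V × V => φ p.1 * (1 / 2 * (G.fracKernel s p.1 p.2 * (u p.1 - u p.2))))
      (∑ x ∈ S, φ x * (1 / 2 * ∑' y, G.fracKernel s x y * (u x - u y))) := by
  obtain ⟨C, hC⟩ := hu
  have hrow : ∀ x, Summable fun y => G.fracKernel s x y * (u x - u y) := fun x =>
    hG.summable_fracKernel_mul hs0 hs1 x (abs_sub_le_two_mul hC x)
  set k : V × V → ℝ := fun p => φ p.1 * (1 / 2 * (G.fracKernel s p.1 p.2 * (u p.1 - u p.2))) with hk
  have hkrow : ∀ x, HasSum (fun y => k (x, y))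
      (φ x * (1 / 2 * ∑' y, G.fracKernel s x y * (u x - u y))) := fun x =>
    ((hrow x).hasSum.mul_left (1 / 2 : ℝ)).mul_left (φ x)
  have hsumm : Summable k := by
    refine Summable.of_norm ?_
    rw [summable_prod_of_nonneg fun p => norm_nonneg _]
    refine ⟨fun x => (hkrow x).summable.norm, ?_⟩
    refine summable_of_ne_finset_zero (s := S) fun x hx => ?_
    simp [hk, hφ x hx]
  have h1 := hsumm.hasSum.prod_fiberwise hkrow
  have h2 : HasSum (fun x => φ x * (1 / 2 * ∑' y, G.fracKernel s x y * (u x - u y)))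
      (∑ x ∈ S, φ x * (1 / 2 * ∑' y, G.fracKernel s x y * (u x - u y))) :=
    hasSum_sum_of_ne_finset_zero fun x hx => by rw [hφ x hx, zero_mul]
  rw [h2.unique h1]
  exact hsumm.hasSum

/-- Summation by parts against a finitely supported function. -/
theorem StochasticallyComplete.hasSum_energyVec_mul (hG : G.StochasticallyComplete)
    (hs0 : 0 < s) (hs1 : s < 1) (hh : ∀ x, 0 ≤ h x) {φ : V → ℝ} {S : Finset V}
    (hφ : ∀ x, x ∉ S → φ x = 0) (hu : ∃ C, ∀ x, |u x| ≤ C) :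
    HasSum (fun p => G.energyVec s h u p * G.energyVec s h φ p)
      (∑ x ∈ S, φ x * G.schrodinger s h u x) := by
  classical
  have hA := hG.hasSum_half_jump_mul hs0 hs1 hφ hu
  -- The half with φ(y) is the previous one with the variables exchanged, by symmetry of W_s.
  have hA' := (Equiv.prodComm V V).hasSum_iff.2 hA
  have hD : HasSum (fun p : V × V => if p.2 = p.1 then h p.1 * G.μ p.1 * u p.1 * φ p.1 else 0)
      (∑ x ∈ S, φ x * (h x * G.μ x * u x)) := by
    have hinj : Function.Injective fun x : V => (x, x) := fun x y e => (Prod.mk.inj e).1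
    have h1 := (hinj.hasSum_iff (f := fun p : V × V =>
      if p.2 = p.1 then h p.1 * G.μ p.1 * u p.1 * φ p.1 else 0) (a := ∑ x ∈ S, φ x *
          (h x * G.μ x * u x))
      fun p hp => if_neg fun e => hp ⟨p.1, Prod.ext rfl e.symm⟩)
    refine h1.1 ?_
    refine (hasSum_sum_of_ne_finset_zero (f := fun x => φ x * (h x * G.μ x * u x)) fun x hx => by
      rw [hφ x hx, zero_mul]).congr_fun fun x => ?_
    simp [mul_comm]
  convert (hD.add hA).add hA' using 1
  · ext ⟨x, y⟩
    rw [energyVec_mul_energyVec hs0 hs1 hh]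
    simp only [Function.comp, Equiv.prodComm_apply, Prod.swap]
    rw [G.fracKernel_symm s y x]
    ring
  · rw [← Finset.sum_add_distrib, ← Finset.sum_add_distrib]
    refine Finset.sum_congr rfl fun x _ => ?_
    rw [schrodinger]
    ring

theorem StochasticallyComplete.summable_energyVec_sq (hG : G.StochasticallyComplete)
    (hs0 : 0 < s) (hs1 : s < 1) (hh : ∀ x, 0 ≤ h x) {φ : V → ℝ}
    (hφ : (Function.support φ).Finite) : Summable fun p => G.energyVec s h φ p ^ 2 := by
  simp only [sq]
  exact (hG.hasSum_energyVec_mul hs0 hs1 hh (S := hφ.toFinset)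
    (fun x hx => by simpa using hx) (exists_abs_le_of_finite_support hφ)).summable

/-- Turns ℋ_s into statements about ℓ²(V × V), where convergence arguments become calculus of
square-summable families. -/
theorem StochasticallyComplete.mem_hs_iff (hG : G.StochasticallyComplete)
    (hs0 : 0 < s) (hs1 : s < 1) (hh : ∀ x, 0 ≤ h x) :
    u ∈ G.hs s h ↔ (∃ C, ∀ x, |u x| ≤ C) ∧ (Summable fun p => G.energyVec s h u p ^ 2) ∧
      ∃ φ : ℕ → V → ℝ, (∀ n, (Function.support (φ n)).Finite) ∧
        Tendsto (fun n => ∑' p, (G.energyVec s h u p - G.energyVec s h (φ n) p) ^ 2) atTop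
          (𝓝 0) := by
  rw [hs, mem_ofPred_eq]
  refine and_congr_right fun hu => ?_
  rw [hG.isIntegrable_energy_iff hs0 hs1 hh hu]
  refine and_congr_right fun hsum => exists_congr fun φ => and_congr_right fun hφ => ?_
  have h1 : ∀ n, G.hsNorm s h (fun x => u x - φ n x) ^ 2 =
      ∑' p, (G.energyVec s h u p - G.energyVec s h (φ n) p) ^ 2 := by
    intro n
    obtain ⟨C, hC⟩ := hu
    obtain ⟨C', hC'⟩ := exists_abs_le_of_finite_support (hφ n)
    have h2 := hsum.sub_sq (hG.summable_energyVec_sq hs0 hs1 hh (hφ n))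
    simp only [← energyVec_sub] at h2 ⊢
    exact hG.hsNorm_sq hs0 hs1 hh ⟨C + C', fun x => (abs_sub _ _).trans
      (add_le_add (hC x) (hC' x))⟩ h2
  simp only [← h1]
  constructor
  · intro ht
    simpa using ht.pow 2
  · intro ht
    have := ht.sqrt
    simpa [Real.sqrt_sq, hsNorm] using this

theorem StochasticallyComplete.mem_hs_of_finite_support (hG : G.StochasticallyComplete)
    (hs0 : 0 < s) (hs1 : s < 1) (hh : ∀ x, 0 ≤ h x) {φ : V → ℝ}
    (hφ : (Function.support φ).Finite) : φ ∈ G.hs s h := by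
  rw [hG.mem_hs_iff hs0 hs1 hh]
  exact ⟨exists_abs_le_of_finite_support hφ, hG.summable_energyVec_sq hs0 hs1 hh hφ,
    fun _ => φ, fun _ => hφ, by simp⟩

/-- Finitely supported functions belong to ℋ_s and so compete in the infimum. This inequality is how
λ₁ enters the finite problems. -/
theorem StochasticallyComplete.lambda1_mul_le (hG : G.StochasticallyComplete)
    (hs0 : 0 < s) (hs1 : s < 1) (hh : ∀ x, 0 ≤ h x) {φ : V → ℝ} {S : Finset V}
    (hφ : ∀ x, x ∉ S → φ x = 0) :
    G.lambda1 s h * ∑ x ∈ S, φ x ^ 2 * G.μ x ≤ ∑ x ∈ S, φ x * G.schrodinger s h φ x := by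
  have hfin : (Function.support φ).Finite :=
    S.finite_toSet.subset fun x hx => by_contra fun hxS => hx (hφ x hxS)
  have hb := exists_abs_le_of_finite_support hfin
  have hE := (hG.hasSum_energyVec_mul hs0 hs1 hh hφ hb).tsum_eq
  simp only [← sq] at hE
  rw [← hE, ← hG.hsNorm_sq hs0 hs1 hh hb (hG.summable_energyVec_sq hs0 hs1 hh hfin)]
  have hL : G.l2Norm φ ^ 2 = ∑ x ∈ S, φ x ^ 2 * G.μ x := by
    have h1 : G.integral (fun x => φ x ^ 2) = ∑ x ∈ S, φ x ^ 2 * G.μ x :=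
      tsum_eq_sum fun x hx => by simp [hφ x hx]
    rw [l2Norm, h1, Real.sq_sqrt (Finset.sum_nonneg fun x _ =>
      mul_nonneg (sq_nonneg _) (G.μ_pos x).le)]
  by_cases h0 : φ = 0
  · simp only [h0, Pi.zero_apply]
    simp only [ne_eq, OfNat.ofNat_ne_zero, not_false_eq_true, zero_pow, zero_mul,
      Finset.sum_const_zero, mul_zero]
    positivity
  · rw [← hL]
    obtain ⟨x, hx⟩ := Function.ne_iff.1 h0
    have hxS : x ∈ S := by_contra fun hxS => hx (hφ x hxS)
    have hpos : 0 < G.l2Norm φ ^ 2 := by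
      rw [hL]
      refine Finset.sum_pos' (fun y _ => mul_nonneg (sq_nonneg _) (G.μ_pos y).le) ⟨x, hxS, ?_⟩
      exact mul_pos (sq_pos_of_ne_zero hx) (G.μ_pos x)
    rw [← le_div_iff₀ hpos]
    exact csInf_le ⟨0, by rintro _ ⟨v, _, _, rfl⟩; positivity⟩
      ⟨φ, hG.mem_hs_of_finite_support hs0 hs1 hh hfin, h0, rfl⟩

end WeightedGraph

/-! ### Primitives of the nonlinearity and of its truncation to the positive axis -/

section Primitive

variable {k : ℝ → ℝ} {α : ℝ}

theorem integral_comp_max_of_nonpos (h0 : k 0 = 0) {y : ℝ} (hy : y ≤ 0) :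
    ∫ t in (0 : ℝ)..y, k (max t 0) = 0 := by
  rw [intervalIntegral.integral_congr (g := fun _ => 0) fun t ht => ?_]
  · simp
  · rw [uIcc_of_ge hy] at ht
    simp [max_eq_right ht.2, h0]

theorem integral_comp_max_of_nonneg {y : ℝ} (hy : 0 ≤ y) :
    ∫ t in (0 : ℝ)..y, k (max t 0) = ∫ t in (0 : ℝ)..y, k t := by
  refine intervalIntegral.integral_congr fun t ht => ?_
  rw [uIcc_of_le hy] at ht
  simp [max_eq_left ht.1]

theorem mul_integral_comp_max_le (h0 : k 0 = 0)
    (hAR : ∀ y, 0 < y → α * (∫ t in (0 : ℝ)..y, k t) ≤ y * k y) (y : ℝ) :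
    α * (∫ t in (0 : ℝ)..y, k (max t 0)) ≤ y * k (max y 0) := by
  rcases le_or_gt y 0 with hy | hy
  · rw [integral_comp_max_of_nonpos h0 hy, max_eq_right hy, h0, mul_zero, mul_zero]
  · rw [integral_comp_max_of_nonneg hy.le, max_eq_left hy.le]
    exact hAR y hy

theorem integral_comp_max_le (hk : Continuous k) (h0 : k 0 = 0) {c δ : ℝ} (hc0 : 0 ≤ c)
    (hc : ∀ y, 0 < y → y < δ → k y ≤ c * y) {y : ℝ} (hy : y < δ) :
    ∫ t in (0 : ℝ)..y, k (max t 0) ≤ c / 2 * y ^ 2 := by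
  rcases le_or_gt y 0 with hy0 | hy0
  · rw [integral_comp_max_of_nonpos h0 hy0]
    positivity
  · rw [integral_comp_max_of_nonneg hy0.le]
    calc ∫ t in (0 : ℝ)..y, k t ≤ ∫ t in (0 : ℝ)..y, c * t := by
          refine intervalIntegral.integral_mono_on hy0.le (hk.intervalIntegrable _ _)
            ((by fun_prop : Continuous fun t => c * t).intervalIntegrable _ _) fun t ht => ?_
          rcases ht.1.eq_or_lt with rfl | ht0
          · simp [h0]
          · exact hc t ht0 (ht.2.trans_lt hy)
      _ = c / 2 * y ^ 2 := by
          rw [intervalIntegral.integral_const_mul, integral_id]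
          ring

/-- The Ambrosetti–Rabinowitz condition forces superquadratic growth of the primitive. -/
theorem exists_mul_sq_le_integral (hk : Continuous k) (hα : 2 < α)
    (hAR : ∀ y, 0 < y → 0 < α * (∫ t in (0 : ℝ)..y, k t) ∧ α * (∫ t in (0 : ℝ)..y, k t) ≤ y * k y)
    (B : ℝ) : ∃ T > 0, B * T ^ 2 ≤ ∫ t in (0 : ℝ)..T, k t := by
  set F : ℝ → ℝ := fun y => ∫ t in (0 : ℝ)..y, k t with hF
  have hder : ∀ y, HasDerivAt F (k y) y := fun y => (hk.integral_hasStrictDerivAt 0 y).hasDerivAt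
  have hα0 : 0 < α := by linarith
  have hF1 : 0 < F 1 := pos_of_mul_pos_right (hAR 1 one_pos).1 hα0.le
  have hder' : ∀ y ∈ Ioi (0 : ℝ), HasDerivAt (fun y => F y * y ^ (-α))
      (k y * y ^ (-α) + F y * (-α * y ^ (-α - 1))) y := fun y hy =>
    (hder y).mul (Real.hasDerivAt_rpow_const (Or.inl (ne_of_gt hy)))
  -- The derivative of F(y)y^{-α} is y^{-α-1}(y k(y) - αF(y)) ≥ 0. Hence F(T) ≥ F(1)T^α for T ≥ 1,
  -- which beats B T² since α > 2.
  have hmono : MonotoneOn (fun y => F y * y ^ (-α)) (Ici 1) := by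
    refine monotoneOn_of_deriv_nonneg (convex_Ici 1) (fun y hy => (hder' y
      (mem_Ioi.2 (zero_lt_one.trans_le (mem_Ici.1 hy)))).continuousAt.continuousWithinAt)
          (fun y hy => ?_) fun y hy => ?_
    · rw [interior_Ici] at hy
      exact (hder' y (mem_Ioi.2 (zero_lt_one.trans
        (mem_Ioi.1 hy)))).differentiableAt.differentiableWithinAt
    · rw [interior_Ici] at hy
      have hy0 : 0 < y := zero_lt_one.trans (mem_Ioi.1 hy)
      rw [(hder' y hy0).deriv]
      have h1 : y ^ (-α) = y ^ (-α - 1) * y := by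
        rw [Real.rpow_sub_one hy0.ne', div_mul_cancel₀ _ hy0.ne']
      rw [h1]
      have h2 := (hAR y hy0).2
      have h3 : 0 ≤ y ^ (-α - 1) := Real.rpow_nonneg hy0.le _
      nlinarith [mul_nonneg h3 (sub_nonneg.2 h2)]
  have hev : ∀ᶠ y : ℝ in atTop, B / F 1 ≤ y ^ (α - 2) :=
    (tendsto_rpow_atTop (by linarith : 0 < α - 2)).eventually_ge_atTop _
  obtain ⟨T, hT, hT1⟩ := (hev.and (eventually_ge_atTop 1)).exists
  have hT0 : 0 < T := zero_lt_one.trans_le hT1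
  refine ⟨T, hT0, ?_⟩
  have h1 := hmono self_mem_Ici hT1 hT1
  simp only [Real.one_rpow, mul_one] at h1
  have h2 : F 1 * T ^ α ≤ F T := by
    calc F 1 * T ^ α ≤ F T * T ^ (-α) * T ^ α :=
          mul_le_mul_of_nonneg_right h1 (Real.rpow_nonneg hT0.le _)
      _ = F T := by rw [mul_assoc, ← Real.rpow_add hT0]; simp
  rw [div_le_iff₀ hF1] at hT
  have h3 : T ^ α = T ^ (α - 2) * T ^ 2 := by
    rw [← Real.rpow_two, ← Real.rpow_add hT0]
    simp
  calc B * T ^ 2 ≤ T ^ (α - 2) * F 1 * T ^ 2 := by gcongr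
    _ = F 1 * T ^ α := by rw [h3]; ring
    _ ≤ F T := h2

end Primitive

/-! ### Finiteness of balls and of sublevel sets of the potential -/

theorem SimpleGraph.Connected.finite_dist_le {V : Type*} {H : SimpleGraph V} [H.LocallyFinite]
    (hH : H.Connected) (x₀ : V) (n : ℕ) : {x | H.dist x x₀ ≤ n}.Finite := by
  induction n with
  | zero =>
    refine (finite_singleton x₀).subset fun x hx => ?_
    simpa using hH.dist_eq_zero_iff.1 (Nat.le_zero.1 hx)
  | succ n ih =>
    refine (ih.union (ih.biUnion fun y _ => (H.neighborFinset y).finite_toSet)).subset fun x hx =>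
      ?_
    obtain ⟨p, hp⟩ := hH.exists_walk_length_eq_dist x x₀
    cases p with
    | nil => left; simp
    | @cons _ y _ hxy q =>
      right
      rw [mem_iUnion₂]
      refine ⟨y, ?_, by simpa using hxy.symm⟩
      have h1 := SimpleGraph.dist_le q
      have h2 : H.dist x x₀ ≤ n + 1 := hx
      rw [SimpleGraph.Walk.length_cons] at hp
      show H.dist y x₀ ≤ n
      omega

/-- Where h ≤ R the distance to x₀ is bounded, and balls are finite. This is the source of
compactness in the limit over finite sets. -/
theorem SimpleGraph.Connected.finite_sublevel {V : Type*} {H : SimpleGraph V} [H.LocallyFinite]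
    (hH : H.Connected) {h : V → ℝ} {x₀ : V}
    (hlim : Tendsto h (comap (fun x => H.dist x x₀) atTop) atTop) (R : ℝ) : {x | h x ≤
        R}.Finite := by
  obtain ⟨s, hs, hsub⟩ := mem_comap.1 (hlim.eventually_gt_atTop R)
  obtain ⟨N, hN⟩ := mem_atTop_sets.1 hs
  refine (hH.finite_dist_le x₀ N).subset fun x hx => ?_
  by_contra hlt
  have h1 : R < h x := hsub (hN _ (not_le.1 hlt).le)
  exact absurd hx (not_le.2 h1)

/-! ### The operator as a symmetric matrix on a finite set -/

namespace WeightedGraph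

variable {V : Type*} {G : WeightedGraph V} [G.graph.LocallyFinite] {s : ℝ} {h u : V → ℝ}

-- Evaluating the energy pairing of u with δ_x by parts on either factor gives the two sides. So the
-- matrix with entries (Lδ_x)(y), restricted to a finite set, represents L there on functions
-- supported in it.
open Classical in
theorem StochasticallyComplete.sum_schrodinger_single (hG : G.StochasticallyComplete)
    (hs0 : 0 < s) (hs1 : s < 1) (hh : ∀ x, 0 ≤ h x) {S : Finset V}
    (hu : ∀ x, x ∉ S → u x = 0) (x : V) :
    ∑ y ∈ S, G.schrodinger s h (Pi.single x 1) y * u y = G.schrodinger s h u x := by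
  have hb : ∃ C, ∀ x, |u x| ≤ C := exists_abs_le_of_finite_support
    (S.finite_toSet.subset fun x hx => by_contra fun hxS => hx (hu x hxS))
  have hb' : ∃ C, ∀ y, |(Pi.single x (1 : ℝ) : V → ℝ) y| ≤ C := exists_abs_le_of_finite_support
    ((finite_singleton x).subset (Pi.support_single_subset))
  have h1 := hG.hasSum_energyVec_mul hs0 hs1 hh (S := {x}) (φ := Pi.single x 1)
    (fun y hy => Pi.single_eq_of_ne (by simpa using hy) _) hb
  have h2 := hG.hasSum_energyVec_mul hs0 hs1 hh hu hb'
  simp only [mul_comm (G.energyVec s h u _)] at h1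
  have h3 := h2.unique h1
  rw [Finset.sum_singleton, Pi.single_eq_same, one_mul] at h3
  rw [← h3]
  exact Finset.sum_congr rfl fun y _ => mul_comm _ _

open Classical in
theorem StochasticallyComplete.schrodinger_single_symm (hG : G.StochasticallyComplete)
    (hs0 : 0 < s) (hs1 : s < 1) (hh : ∀ x, 0 ≤ h x) (x y : V) :
    G.schrodinger s h (Pi.single x 1) y = G.schrodinger s h (Pi.single y 1) x := by
  have h1 := hG.sum_schrodinger_single hs0 hs1 hh (S := {y}) (u := Pi.single y 1)
    (fun z hz => Pi.single_eq_of_ne (by simpa using hz) _) x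
  rwa [Finset.sum_singleton, Pi.single_eq_same, mul_one] at h1

open Classical in
theorem StochasticallyComplete.sum_sum_schrodinger_single (hG : G.StochasticallyComplete)
    (hs0 : 0 < s) (hs1 : s < 1) (hh : ∀ x, 0 ≤ h x) {S : Finset V}
    (hu : ∀ x, x ∉ S → u x = 0) :
    ∑ x : S, ∑ y : S, G.schrodinger s h (Pi.single (x : V) 1) y * u x * u y =
      ∑ x ∈ S, u x * G.schrodinger s h u x := by
  rw [← Finset.sum_coe_sort S fun x => u x * G.schrodinger s h u x]
  refine Finset.sum_congr rfl fun x _ => ?_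
  rw [← hG.sum_schrodinger_single hs0 hs1 hh hu x, Finset.mul_sum,
    ← Finset.sum_coe_sort S fun y => u x * (G.schrodinger s h (Pi.single (x : V) 1) y * u y)]
  exact Finset.sum_congr rfl fun y _ => by ring

/-- Only the diagonal entries of `energyVec` are kept. Both the sup bound and the tightness of the
Dirichlet solutions come from here. -/
theorem StochasticallyComplete.sum_mul_sq_le_energy (hG : G.StochasticallyComplete)
    (hs0 : 0 < s) (hs1 : s < 1) (hh : ∀ x, 0 ≤ h x) {S : Finset V}
    (hu : ∀ x, x ∉ S → u x = 0) (T : Finset V) :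
    ∑ x ∈ T, h x * G.μ x * u x ^ 2 ≤ ∑ x ∈ S, u x * G.schrodinger s h u x := by
  have hfin : (Function.support u).Finite :=
    S.finite_toSet.subset fun x hx => by_contra fun hxS => hx (hu x hxS)
  have h1 := hG.hasSum_energyVec_mul hs0 hs1 hh hu (exists_abs_le_of_finite_support hfin)
  have hinj : Function.Injective fun x : V => (x, x) := fun x y e => (Prod.mk.inj e).1
  have h2 := sum_le_hasSum (T.map ⟨_, hinj⟩) (fun p _ => mul_self_nonneg _) h1
  rw [Finset.sum_map] at h2
  refine le_trans (le_of_eq (Finset.sum_congr rfl fun x _ => ?_)) h2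
  simp only [Function.Embedding.coeFn_mk, energyVec, if_true]
  have := Real.mul_self_sqrt (mul_nonneg (hh x) (G.μ_pos x).le)
  linear_combination (-u x ^ 2) * this

/-- A minimum principle for finitely supported functions. -/
theorem StochasticallyComplete.nonneg_of_schrodinger_nonneg
    (hs0 : 0 < s) (hs1 : s < 1) (hh : ∀ x, 0 < h x) {S : Finset V}
    (hu : ∀ x, x ∉ S → u x = 0) (hL : ∀ x ∈ S, u x < 0 → 0 ≤ G.schrodinger s h u x) (x : V) :
    0 ≤ u x := by
  by_contra! hx
  have hxS : x ∈ S := by_contra fun hxS => hx.ne (hu x hxS)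
  obtain ⟨z, hzS, hz⟩ := S.exists_min_image u ⟨x, hxS⟩
  have hz0 : u z < 0 := (hz x hxS).trans_lt hx
  have hmin : ∀ y, u z ≤ u y := by
    intro y
    by_cases hy : y ∈ S
    · exact hz y hy
    · rw [hu y hy]
      exact hz0.le
  have h1 : ∑' y, G.fracKernel s z y * (u z - u y) ≤ 0 :=
    tsum_nonpos fun y => mul_nonpos_of_nonneg_of_nonpos (G.fracKernel_nonneg hs0 hs1 z y)
      (sub_nonpos.2 (hmin y))
  have h2 := hL z hzS hz0
  have h3 : h z * G.μ z * u z < 0 := mul_neg_of_pos_of_neg (mul_pos (hh z) (G.μ_pos z)) hz0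
  rw [schrodinger] at h2
  linarith

end WeightedGraph

/-! ### Dirichlet solutions with bounds uniform in the finite set -/

namespace WeightedGraph

variable {V : Type*} {G : WeightedGraph V} [G.graph.LocallyFinite] {s : ℝ} {h u : V → ℝ}
  {f : V → ℝ → ℝ}

open Classical in
theorem StochasticallyComplete.latticeAction_restrict (hG : G.StochasticallyComplete)
    (hs0 : 0 < s) (hs1 : s < 1) (hh : ∀ x, 0 ≤ h x) {D : Finset V} (hu : ∀ x, x ∉ D → u x = 0) :
    latticeAction (fun x y : D => G.schrodinger s h (Pi.single (x : V) 1) y)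
        (fun (x : D) y => G.μ x * f x (max y 0)) (fun x => u x) =
      1 / 2 * ∑ x ∈ D, u x * G.schrodinger s h u x -
        ∑ x ∈ D, G.μ x * ∫ t in (0 : ℝ)..u x, f x (max t 0) := by
  rw [latticeAction, hG.sum_sum_schrodinger_single hs0 hs1 hh hu]
  simp only [intervalIntegral.integral_const_mul]
  rw [Finset.sum_coe_sort D fun x => G.μ x * ∫ t in (0 : ℝ)..u x, f x (max t 0)]

-- On multiples of δ_{x₀} the action does not see D, which makes the mountain pass level uniformly
-- bounded.
open Classical in
theorem StochasticallyComplete.latticeAction_single (hG : G.StochasticallyComplete)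
    (hs0 : 0 < s) (hs1 : s < 1) (hh : ∀ x, 0 ≤ h x) {D : Finset V} {x₀ : V} (hx₀ : x₀ ∈ D) (r : ℝ) :
    latticeAction (fun x y : D => G.schrodinger s h (Pi.single (x : V) 1) y)
        (fun (x : D) y => G.μ x * f x (max y 0)) (fun x => (Pi.single x₀ r : V → ℝ) x) =
      1 / 2 * (r ^ 2 * G.schrodinger s h (Pi.single x₀ 1) x₀) -
        G.μ x₀ * ∫ t in (0 : ℝ)..r, f x₀ (max t 0) := by
  have hne : ∀ {x}, x ≠ x₀ → (Pi.single x₀ r : V → ℝ) x = 0 := fun hx => by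
    rw [Pi.single_apply, if_neg hx]
  rw [hG.latticeAction_restrict hs0 hs1 hh (u := Pi.single x₀ r) fun x hx => hne fun e => hx
    (e ▸ hx₀),
    Finset.sum_eq_single_of_mem x₀ hx₀ fun x _ hx => by rw [hne hx, zero_mul],
    Finset.sum_eq_single_of_mem x₀ hx₀ fun x _ hx => by rw [hne hx]; simp, Pi.single_eq_same]
  have h1 := hG.sum_schrodinger_single hs0 hs1 hh (S := {x₀}) (u := Pi.single x₀ r)
    (fun z hz => hne (by simpa using hz)) x₀
  rw [Finset.sum_singleton, Pi.single_eq_same] at h1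
  rw [← h1]
  ring

/-- Mountain pass solutions of the Dirichlet problem on finite sets, with energy bounds that do
not depend on the set. -/
theorem StochasticallyComplete.exists_dirichlet_solution (hG : G.StochasticallyComplete)
    (hs0 : 0 < s) (hs1 : s < 1) {μ₀ : ℝ} (hμ₀ : 0 < μ₀) (hμ : ∀ x, μ₀ ≤ G.μ x)
    (hh : ∀ x, 0 < h x) (F1 : ∀ x, Continuous (f x) ∧ f x 0 = 0) {α : ℝ} (hα : 2 < α)
    (hAR : ∀ x, ∀ y : ℝ, 0 < y → 0 < α * (∫ t in (0 : ℝ)..y, f x t) ∧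
      α * (∫ t in (0 : ℝ)..y, f x t) ≤ y * f x y) {c δ : ℝ} (hc0 : 0 ≤ c)
    (hcl : c < G.lambda1 s h) (hδ : 0 < δ) (hc : ∀ x y, 0 < y → y < δ → f x y ≤ c * y) (x₀ : V) :
    ∃ K, ∀ D : Finset V, x₀ ∈ D → ∃ u : V → ℝ, (∀ x, 0 ≤ u x) ∧ (∀ x, x ∉ D → u x = 0) ∧
      (∀ x ∈ D, G.schrodinger s h u x = G.μ x * f x (u x)) ∧
      ∑ x ∈ D, u x * G.schrodinger s h u x ≤ K ∧ ∃ x, δ ≤ u x := by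
  classical
  have hh' : ∀ x, 0 ≤ h x := fun x => (hh x).le
  set l₁ := G.lambda1 s h
  have hl : 0 < l₁ := hc0.trans_lt hcl
  have hfm : ∀ x, Continuous fun y => f x (max y 0) := fun x =>
    (F1 x).1.comp (continuous_id.max continuous_const)
  -- The constant is the one for which the primitive at T, times μ(x₀), outweighs half the energy of
  -- Tδ_{x₀}.
  obtain ⟨T, hT0, hT⟩ := exists_mul_sq_le_integral (F1 x₀).1 hα (hAR x₀)
    (G.schrodinger s h (Pi.single x₀ 1) x₀ / (2 * G.μ x₀))
  set A : ℝ → ℝ := fun r => 1 / 2 * (r ^ 2 * G.schrodinger s h (Pi.single x₀ 1) x₀) -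
    G.μ x₀ * ∫ t in (0 : ℝ)..r, f x₀ (max t 0) with hA
  have hAc : Continuous A := by
    have : Continuous fun r => ∫ t in (0 : ℝ)..r, f x₀ (max t 0) :=
      intervalIntegral.continuous_primitive (fun a b => (hfm x₀).intervalIntegrable a b) 0
    fun_prop
  have hAT : A T ≤ 0 := by
    rw [div_mul_eq_mul_div, div_le_iff₀ (mul_pos two_pos (G.μ_pos x₀))] at hT
    simp only [hA]
    rw [integral_comp_max_of_nonneg hT0.le]
    linarith
  obtain ⟨b, hb⟩ := (isCompact_Icc.image hAc : IsCompact (A '' Icc 0 T)).bddAbove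
  -- At a critical point the gradient term in `energy_le_latticeAction` vanishes, leaving (α/2 - 1)
  -- times the energy at most αb.
  refine ⟨α * b / (α / 2 - 1), fun D hx₀ => ?_⟩
  have hsub : ∀ v : D → ℝ, ∃ w : V → ℝ, (∀ x, x ∉ D → w x = 0) ∧ v = fun x : D => w x := by
    intro v
    refine ⟨fun x => if hx : x ∈ D then v ⟨x, hx⟩ else 0, fun x hx => dif_neg hx, ?_⟩
    ext x
    simp
  have hsumsq : ∀ w : V → ℝ, μ₀ * ∑ x : D, w x ^ 2 ≤ ∑ x ∈ D, w x ^ 2 * G.μ x := by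
    intro w
    rw [Finset.sum_coe_sort D fun x => w x ^ 2, Finset.mul_sum]
    refine Finset.sum_le_sum fun x _ => ?_
    rw [mul_comm]
    exact mul_le_mul_of_nonneg_left (hμ x) (sq_nonneg _)
  have hARm : ∀ (x : D) y, α * (∫ t in (0 : ℝ)..y, G.μ x * f x (max t 0)) ≤
      y * (G.μ x * f x (max y 0)) := by
    intro x y
    rw [intervalIntegral.integral_const_mul]
    have := mul_le_mul_of_nonneg_left (mul_integral_comp_max_le (F1 x).2
      (fun y hy => (hAR x y hy).2) y) (G.μ_pos x).le
    linarith
  -- Half the energy is at least λ₁‖u‖₂²/2 and, when |u| ≤ δ/2, the primitive term is at most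
  -- c‖u‖₂²/2; the difference, with μ ≥ μ₀, gives `κ'`.
  obtain ⟨v, hv0, hv, hvI⟩ := exists_solution_of_finite_system
    (a := fun x y : D => G.schrodinger s h (Pi.single (x : V) 1) y)
    (k := fun (x : D) y => G.μ x * f x (max y 0)) (α := α) (κ := l₁ * μ₀)
    (κ' := (l₁ - c) / 2 * μ₀) (r₀ := δ / 2) (e := fun x => (Pi.single x₀ T : V → ℝ) x) (c := b)
    (fun x y => hG.schrodinger_single_symm hs0 hs1 hh' x y)
    (fun x => (hfm x).const_mul _) hα hARm (mul_pos hl hμ₀)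
    (fun v => by
      obtain ⟨w, hw, rfl⟩ := hsub v
      rw [hG.sum_sum_schrodinger_single hs0 hs1 hh' hw, mul_assoc]
      exact (mul_le_mul_of_nonneg_left (hsumsq w) hl.le).trans (hG.lambda1_mul_le hs0 hs1 hh' hw))
    (mul_pos (by linarith) hμ₀) (by linarith)
    (fun v hv => by
      obtain ⟨w, hw, rfl⟩ := hsub v
      rw [hG.latticeAction_restrict hs0 hs1 hh' hw, mul_assoc]
      have h1 := hG.lambda1_mul_le hs0 hs1 hh' hw
      have h2 := mul_le_mul_of_nonneg_left (hsumsq w) (by linarith : 0 ≤ (l₁ - c) / 2)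
      have h3 : ∑ x ∈ D, G.μ x * ∫ t in (0 : ℝ)..w x, f x (max t 0) ≤
          c / 2 * ∑ x ∈ D, w x ^ 2 * G.μ x := by
        rw [Finset.mul_sum]
        refine Finset.sum_le_sum fun x hx => ?_
        have h4 := integral_comp_max_le (F1 x).1 (F1 x).2 hc0 (hc x) (y := w x)
          (by linarith [le_abs_self (w x), hv ⟨x, hx⟩])
        nlinarith [mul_le_mul_of_nonneg_left h4 (G.μ_pos x).le]
      linarith)
    (fun e => hT0.ne' (by simpa using congrFun e ⟨x₀, hx₀⟩))
    (by rw [hG.latticeAction_single hs0 hs1 hh' hx₀]; exact hAT)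
    (fun t ht => by
      have h1 : (t • fun x : D => (Pi.single x₀ T : V → ℝ) x) =
          fun x : D => (Pi.single x₀ (t * T) : V → ℝ) x := by
        ext x
        simp [Pi.single_apply]
      rw [h1, hG.latticeAction_single hs0 hs1 hh' hx₀]
      exact hb ⟨t * T, ⟨mul_nonneg ht.1 hT0.le, mul_le_of_le_one_left hT0.le ht.2⟩, rfl⟩)
  obtain ⟨w, hw, rfl⟩ := hsub v
  have heq : ∀ x ∈ D, G.schrodinger s h w x = G.μ x * f x (max (w x) 0) := by
    intro x hx
    rw [← hG.sum_schrodinger_single hs0 hs1 hh' hw x, ← Finset.sum_coe_sort D]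
    exact hv ⟨x, hx⟩
  have hw0 : ∀ x, 0 ≤ w x := nonneg_of_schrodinger_nonneg hs0 hs1 hh hw fun x hx hneg => by
    rw [heq x hx, max_eq_right hneg.le, (F1 x).2, mul_zero]
  have heq' : ∀ x ∈ D, G.schrodinger s h w x = G.μ x * f x (w x) := fun x hx => by
    rw [heq x hx, max_eq_left (hw0 x)]
  refine ⟨w, hw0, hw, heq', ?_, ?_⟩
  · have h1 := energy_le_latticeAction (a := fun x y : D => G.schrodinger s h (Pi.single
    (x : V) 1) y)
      hARm fun x => w x
    have h2 : ∑ x : D, w x * (∑ y : D, G.schrodinger s h (Pi.single (x : V) 1) y * w y -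
        G.μ x * f x (max (w x) 0)) = 0 :=
      Finset.sum_eq_zero fun x _ => by rw [hv x, sub_self, mul_zero]
    rw [hG.sum_sum_schrodinger_single hs0 hs1 hh' hw, h2, add_zero] at h1
    rw [le_div_iff₀ (by linarith), mul_comm]
    exact h1.trans (mul_le_mul_of_nonneg_left hvI (by linarith))
  -- If w < δ everywhere, the equation bounds the energy by c‖w‖₂², whereas it is at least λ₁‖w‖₂²;
  -- then w = 0.
  · by_contra! hlt
    have h1 := hG.lambda1_mul_le hs0 hs1 hh' hw
    have h2 : ∑ x ∈ D, w x * G.schrodinger s h w x ≤ c * ∑ x ∈ D, w x ^ 2 * G.μ x := by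
      rw [Finset.mul_sum]
      refine Finset.sum_le_sum fun x hx => ?_
      rw [heq' x hx]
      rcases (hw0 x).eq_or_lt with h0 | h0
      · rw [← h0]
        simp
      · have := mul_le_mul_of_nonneg_left (hc x (w x) h0 (hlt x))
          (mul_nonneg (G.μ_pos x).le (hw0 x))
        linarith
    have h3 : ∑ x ∈ D, w x ^ 2 * G.μ x ≤ 0 := by
      by_contra! hpos
      have : c * ∑ x ∈ D, w x ^ 2 * G.μ x < l₁ * ∑ x ∈ D, w x ^ 2 * G.μ x :=
        mul_lt_mul_of_pos_right hcl hpos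
      linarith
    have hnn : ∀ x ∈ D, 0 ≤ w x ^ 2 * G.μ x := fun x _ => mul_nonneg (sq_nonneg _) (G.μ_pos x).le
    have h4 := (Finset.sum_eq_zero_iff_of_nonneg hnn).1 (le_antisymm h3 (Finset.sum_nonneg hnn))
    refine hv0 (funext fun x => ?_)
    have := h4 x x.2
    simpa [(G.μ_pos x).ne'] using this

end WeightedGraph

/-! ### Convergence of sums under a coercive weight -/

section Tightness

variable {V β : Type*} {h : V → ℝ} {K : ℝ}

theorem summable_of_weighted_sum_le {h₀ : ℝ} (hh₀ : 0 < h₀) (hh : ∀ x, h₀ ≤ h x) {g : V → ℝ}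
    (hg : ∀ x, 0 ≤ g x) (hK : ∀ T : Finset V, ∑ x ∈ T, h x * g x ≤ K) : Summable g := by
  refine summable_of_sum_le hg (c := K / h₀) fun T => ?_
  rw [le_div_iff₀ hh₀, mul_comm, Finset.mul_sum]
  exact (Finset.sum_le_sum fun x _ => mul_le_mul_of_nonneg_right (hh x) (hg x)).trans (hK T)

/-- Pointwise convergence and a uniform bound against a coercive weight give convergence of the
sums. -/
theorem tendsto_tsum_of_weighted_sum_le {h₀ : ℝ} (hh₀ : 0 < h₀) (hh : ∀ x, h₀ ≤ h x)
    (hfin : ∀ R, {x | h x ≤ R}.Finite) {l : Filter β} [l.NeBot] {g : β → V → ℝ} {g' : V → ℝ}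
    (hg : ∀ n x, 0 ≤ g n x) (hK : ∀ n (T : Finset V), ∑ x ∈ T, h x * g n x ≤ K)
    (hlim : ∀ x, Tendsto (fun n => g n x) l (𝓝 (g' x))) :
    Summable g' ∧ Tendsto (fun n => ∑' x, g n x) l (𝓝 (∑' x, g' x)) := by
  classical
  have hg' : ∀ x, 0 ≤ g' x := fun x => ge_of_tendsto' (hlim x) fun n => hg n x
  have hK' : ∀ T : Finset V, ∑ x ∈ T, h x * g' x ≤ K := fun T =>
    le_of_tendsto' (tendsto_finsetSum T fun x _ => (hlim x).const_mul (h x)) fun n => hK n T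
  have hsum' := summable_of_weighted_sum_le hh₀ hh hg' hK'
  -- Outside {h ≤ R} one has k ≤ hk/R, so the tail is at most K/R, uniformly in the family.
  have htail : ∀ (k : V → ℝ), (∀ x, 0 ≤ k x) → (∀ T : Finset V, ∑ x ∈ T, h x * k x ≤ K) →
      ∀ R, (hR : 0 < R) → |∑' x, k x - ∑ x ∈ (hfin R).toFinset, k x| ≤ K / R := by
    intro k hk hkK R hR
    have hks := summable_of_weighted_sum_le hh₀ hh hk hkK
    have h1 := hks.sum_le_tsum (hfin R).toFinset fun x _ => hk x
    rw [abs_of_nonneg (sub_nonneg.2 h1), sub_le_iff_le_add]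
    refine hks.tsum_le_of_sum_le fun T => ?_
    rw [← Finset.sum_sdiff (Finset.inter_subset_left (s₁ := T) (s₂ := (hfin R).toFinset))]
    refine add_le_add ?_ (Finset.sum_le_sum_of_subset_of_nonneg Finset.inter_subset_right
      fun x _ _ => hk x)
    rw [le_div_iff₀ hR, mul_comm, Finset.mul_sum]
    refine (Finset.sum_le_sum fun x hx => mul_le_mul_of_nonneg_right ?_ (hk x)).trans (hkK _)
    simp only [Finset.mem_sdiff, Finset.mem_inter, Finite.mem_toFinset, mem_ofPred_eq, not_and,
      not_le] at hx
    exact (hx.2 hx.1).le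
  refine ⟨hsum', Metric.tendsto_nhds.2 fun ε hε => ?_⟩
  set R := (3 * (|K| + 1)) / ε with hR
  have hRpos : 0 < R := by positivity
  have hKR : K / R < ε / 3 := by
    rw [div_lt_iff₀ hRpos, hR]
    field_simp
    linarith [le_abs_self K]
  have hF : Tendsto (fun n => ∑ x ∈ (hfin R).toFinset, g n x) l
      (𝓝 (∑ x ∈ (hfin R).toFinset, g' x)) := tendsto_finsetSum _ fun x _ => hlim x
  filter_upwards [Metric.tendsto_nhds.1 hF (ε / 3) (by positivity)] with n hn
  have h1 := abs_le.1 (htail (g n) (hg n) (hK n) R hRpos)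
  have h2 := abs_le.1 (htail g' hg' hK' R hRpos)
  rw [Real.dist_eq, abs_lt] at hn ⊢
  constructor <;> linarith [h1.1, h1.2, h2.1, h2.2, hn.1, hn.2]

end Tightness

/-! ### Strong convergence, weak and pointwise solutions, strong maximum principle -/

namespace WeightedGraph

variable {V : Type*} {G : WeightedGraph V} [G.graph.LocallyFinite] {s : ℝ} {h u : V → ℝ}
  {f : V → ℝ → ℝ}

theorem energyVec_diag (s : ℝ) (h u : V → ℝ) (x : V) :
    G.energyVec s h u (x, x) = √(h x * G.μ x) * u x := by
  simp [energyVec]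

/-- Dominated convergence for series, with bound 2M W_s(x,·); it holds along any filter, so it
applies to an ultrafilter. -/
theorem StochasticallyComplete.tendsto_schrodinger (hG : G.StochasticallyComplete)
    (hs0 : 0 < s) (hs1 : s < 1) {β : Type*} {l : Filter β} {w : β → V → ℝ} {M : ℝ}
    (hM : ∀ n x, |w n x| ≤ M) (hlim : ∀ x, Tendsto (fun n => w n x) l (𝓝 (u x))) (x : V) :
    Tendsto (fun n => G.schrodinger s h (w n) x) l (𝓝 (G.schrodinger s h u x)) := by
  refine Tendsto.add ?_ ((hlim x).const_mul _)
  refine tendsto_tsum_of_dominated_convergence (bound := fun y => G.fracKernel s x y * (2 * M))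
    ((hG.summable_fracKernel hs0 hs1 x).mul_right _)
    (fun y => ((hlim x).sub (hlim y)).const_mul _) (Eventually.of_forall fun n y => ?_)
  rw [norm_mul, Real.norm_of_nonneg (G.fracKernel_nonneg hs0 hs1 x y)]
  exact mul_le_mul_of_nonneg_left (abs_sub_le_two_mul (hM n) x y) (G.fracKernel_nonneg hs0 hs1 x y)

/-- Strong convergence of Dirichlet solutions to their pointwise limit. -/
theorem StochasticallyComplete.mem_hs_of_tendsto (hG : G.StochasticallyComplete)
    (hs0 : 0 < s) (hs1 : s < 1) {h₀ : ℝ} (hh₀ : 0 < h₀) (hh : ∀ x, h₀ ≤ h x)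
    (hfin : ∀ R, {x | h x ≤ R}.Finite) (hf : ∀ x, Continuous (f x)) {C M K : ℝ}
    (hfC : ∀ x y, 0 ≤ y → y ≤ M → 0 ≤ f x y ∧ f x y ≤ C * y)
    {β : Type*} {l : Filter β} [l.NeBot] {w : β → V → ℝ} {D : β → Finset V}
    (hw0 : ∀ n x, 0 ≤ w n x) (hwM : ∀ n x, w n x ≤ M) (hsupp : ∀ n x, x ∉ D n → w n x = 0)
    (hsol : ∀ n, ∀ x ∈ D n, G.schrodinger s h (w n) x = G.μ x * f x (w n x))
    (hK : ∀ n, ∑ x ∈ D n, w n x * G.schrodinger s h (w n) x ≤ K)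
    (hlim : ∀ x, Tendsto (fun n => w n x) l (𝓝 (u x)))
    (hu : ∀ x, G.schrodinger s h u x = G.μ x * f x (u x)) : u ∈ G.hs s h := by
  have hh' : ∀ x, 0 ≤ h x := fun x => hh₀.le.trans (hh x)
  have hu0 : ∀ x, 0 ≤ u x := fun x => ge_of_tendsto' (hlim x) fun n => hw0 n x
  have huM : ∀ x, u x ≤ M := fun x => le_of_tendsto' (hlim x) fun n => hwM n x
  have hub : ∃ C, ∀ x, |u x| ≤ C := ⟨M, fun x => by rw [abs_of_nonneg (hu0 x)]; exact huM x⟩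
  have hwfin : ∀ n, (Function.support (w n)).Finite := fun n =>
    (D n).finite_toSet.subset fun x hx => by_contra fun hxS => hx (hsupp n x hxS)
  rcases isEmpty_or_nonempty V with hV | ⟨⟨x₀⟩⟩
  · exact hG.mem_hs_of_finite_support hs0 hs1 hh' (toFinite _)
  have hM0 : 0 ≤ M := (hu0 x₀).trans (huM x₀)
  have hKw : ∀ n (T : Finset V), ∑ x ∈ T, h x * G.μ x * w n x ^ 2 ≤ K := fun n T =>
    (hG.sum_mul_sq_le_energy hs0 hs1 hh' (hsupp n) T).trans (hK n)
  have hKu : ∀ T : Finset V, ∑ x ∈ T, h x * G.μ x * u x ^ 2 ≤ K := fun T =>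
    le_of_tendsto' (tendsto_finsetSum T fun x _ => ((hlim x).pow 2).const_mul _) fun n => hKw n T
  have hfw : ∀ x, Tendsto (fun n => f x (w n x)) l (𝓝 (f x (u x))) := fun x =>
    ((hf x).tendsto _).comp (hlim x)
  -- Young's inequality yz ≤ (y² + z²)/2 together with f(x,z) ≤ |C|z, all weighted by hμ.
  have hC : ∀ x y z, 0 ≤ y → 0 ≤ z → z ≤ M →
      h x * (y * (G.μ x * f x z)) ≤ |C| / 2 * (h x * G.μ x * y ^ 2) + |C| / 2 *
          (h x * G.μ x * z ^ 2) := by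
    intro x y z hy hz hzM
    have h1 : f x z ≤ |C| * z := (hfC x z hz hzM).2.trans (by gcongr; exact le_abs_self C)
    have h2 : 0 ≤ h x * G.μ x := mul_nonneg (hh' x) (G.μ_pos x).le
    have h3 := mul_le_mul_of_nonneg_left h1 (mul_nonneg h2 hy)
    have h4 := mul_nonneg (mul_nonneg h2 (abs_nonneg C)) (sq_nonneg (y - z))
    linarith
  have hbound : ∀ (y z : V → ℝ), (∀ x, 0 ≤ y x) → (∀ x, 0 ≤ z x) → (∀ x, z x ≤ M) →
      (∀ T : Finset V, ∑ x ∈ T, h x * G.μ x * y x ^ 2 ≤ K) →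
      (∀ T : Finset V, ∑ x ∈ T, h x * G.μ x * z x ^ 2 ≤ K) → ∀ T : Finset V,
      ∑ x ∈ T, h x * (y x * (G.μ x * f x (z x))) ≤ |C| * K := by
    intro y z hy hz hzM hyK hzK T
    refine (Finset.sum_le_sum fun x _ => hC x (y x) (z x) (hy x) (hz x) (hzM x)).trans ?_
    rw [Finset.sum_add_distrib, ← Finset.mul_sum, ← Finset.mul_sum]
    nlinarith [mul_le_mul_of_nonneg_left (hyK T) (abs_nonneg C),
      mul_le_mul_of_nonneg_left (hzK T) (abs_nonneg C)]
  have hnn : ∀ x y z, 0 ≤ y → 0 ≤ z → z ≤ M → 0 ≤ y * (G.μ x * f x z) := fun x y z hy hz hzM =>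
    mul_nonneg hy (mul_nonneg (G.μ_pos x).le (hfC x z hz hzM).1)
  set b := ∑' x, u x * (G.μ x * f x (u x))
  have hlim1 : Tendsto (fun n => ∑' x, w n x * (G.μ x * f x (w n x))) l (𝓝 b) :=
    (tendsto_tsum_of_weighted_sum_le hh₀ hh hfin (fun n x => hnn x _ _ (hw0 n x) (hw0 n x)
        (hwM n x))
      (fun n => hbound _ _ (hw0 n) (hw0 n) (hwM n) (hKw n) (hKw n))
      fun x => (hlim x).mul ((hfw x).const_mul _)).2
  have hlim2 : Tendsto (fun n => ∑' x, w n x * (G.μ x * f x (u x))) l (𝓝 b) :=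
    (tendsto_tsum_of_weighted_sum_le hh₀ hh hfin (fun n x => hnn x _ _ (hw0 n x) (hu0 x) (huM x))
      (fun n => hbound _ _ (hw0 n) hu0 huM (hKw n) hKu)
      fun x => (hlim x).mul_const _).2
  have hJw : ∀ n, Summable fun p => G.energyVec s h (w n) p ^ 2 := fun n =>
    hG.summable_energyVec_sq hs0 hs1 hh' (hwfin n)
  have hE1 : ∀ n, ∑' p, G.energyVec s h (w n) p ^ 2 = ∑' x, w n x * (G.μ x * f x (w n x)) := by
    intro n
    simp only [sq]
    rw [(hG.hasSum_energyVec_mul hs0 hs1 hh' (hsupp n)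
      (exists_abs_le_of_finite_support (hwfin n))).tsum_eq,
      tsum_eq_sum (s := D n) fun x hx => by rw [hsupp n x hx, zero_mul]]
    exact Finset.sum_congr rfl fun x hx => by rw [hsol n x hx]
  have hE2 : ∀ n, ∑' p, G.energyVec s h u p * G.energyVec s h (w n) p =
      ∑' x, w n x * (G.μ x * f x (u x)) := by
    intro n
    rw [(hG.hasSum_energyVec_mul hs0 hs1 hh' (hsupp n) hub).tsum_eq,
      tsum_eq_sum (s := D n) fun x hx => by rw [hsupp n x hx, zero_mul]]
    exact Finset.sum_congr rfl fun x hx => by rw [hu x]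
  have hfatou : ∀ T : Finset (V × V), ∑ p ∈ T, G.energyVec s h u p ^ 2 ≤ b := by
    intro T
    have hp : ∀ p, Tendsto (fun n => G.energyVec s h (w n) p) l (𝓝 (G.energyVec s h u p)) := by
      intro p
      simp only [energyVec]
      split_ifs
      · exact (hlim _).const_mul _
      · exact ((hlim _).sub (hlim _)).const_mul _
    refine le_of_tendsto_of_tendsto' (tendsto_finsetSum T fun p _ => (hp p).pow 2) hlim1 fun n => ?_
    rw [← hE1]
    exact (hJw n).sum_le_tsum T fun p _ => sq_nonneg _
  have hJu : Summable fun p => G.energyVec s h u p ^ 2 :=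
    summable_of_sum_le (fun p => sq_nonneg _) hfatou
  have hJub : ∑' p, G.energyVec s h u p ^ 2 ≤ b := hJu.tsum_le_of_sum_le hfatou
  -- Expand ‖u - w‖² = ‖u‖² - 2⟨u, w⟩ + ‖w‖². Fatou gives ‖u‖² ≤ b, and the equations for u and w
  -- turn the pairing and ‖w‖² into sums that both tend to b.
  have hstrong : Tendsto (fun n => ∑' p, (G.energyVec s h u p - G.energyVec s h (w n) p) ^ 2) l
      (𝓝 0) := by
    have h1 := (hlim2.const_mul 2).const_sub b |>.add hlim1
    rw [show b - 2 * b + b = 0 by ring] at h1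
    refine squeeze_zero (fun n => tsum_nonneg fun p => sq_nonneg _) (fun n => ?_) h1
    rw [tsum_sub_sq hJu (hJw n), hE1, hE2]
    linarith
  rw [hG.mem_hs_iff hs0 hs1 hh']
  have hseq : ∀ k : ℕ, ∃ n, ∑' p, (G.energyVec s h u p - G.energyVec s h (w n) p) ^ 2 <
      1 / ((k : ℝ) + 1) := fun k => (hstrong.eventually_lt_const (by positivity)).exists
  choose n hn using hseq
  exact ⟨hub, hJu, fun k => w (n k), fun k => hwfin _,
    squeeze_zero (fun k => tsum_nonneg fun p => sq_nonneg _) (fun k => (hn k).le)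
      tendsto_one_div_add_atTop_nhds_zero_nat⟩

/-- Against finitely supported functions the weak form is summation by parts. Both sides are
continuous in the ℋ_s norm by Cauchy–Schwarz, so it extends to all test functions. -/
theorem StochasticallyComplete.isWeakSolution (hG : G.StochasticallyComplete)
    (hs0 : 0 < s) (hs1 : s < 1) {h₀ : ℝ} (hh₀ : 0 < h₀) (hh : ∀ x, h₀ ≤ h x) {C : ℝ}
    (hfC : ∀ x, |f x (u x)| ≤ C * |u x|) (hmem : u ∈ G.hs s h)
    (hu : ∀ x, G.schrodinger s h u x = G.μ x * f x (u x)) : G.IsWeakSolution s h f u := by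
  have hh' : ∀ x, 0 < h x := fun x => hh₀.trans_le (hh x)
  have hh0 : ∀ x, 0 ≤ h x := fun x => (hh' x).le
  refine ⟨hmem, fun v hv => ?_⟩
  obtain ⟨hub, hJu, -⟩ := (hG.mem_hs_iff hs0 hs1 hh0).1 hmem
  obtain ⟨hvb, hJv, φ, hφ, hφv⟩ := (hG.mem_hs_iff hs0 hs1 hh0).1 hv
  have huv := hG.hasSum_energy hs0 hs1 hh0 hub hvb (hJu.mul_of_sq hJv)
  set r : V → ℝ := fun x => √(h x * G.μ x) with hr
  have hrpos : ∀ x, 0 < r x := fun x => Real.sqrt_pos.2 (mul_pos (hh' x) (G.μ_pos x))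
  have hrsq : ∀ x, r x ^ 2 = h x * G.μ x := fun x =>
    Real.sq_sqrt (mul_pos (hh' x) (G.μ_pos x)).le
  -- Chosen so that q(x) times the diagonal entry of the energy vector of v is f(x,u)vμ. It is
  -- square summable because |f(x,u)| ≤ C|u| and h ≥ h₀.
  set q : V → ℝ := fun x => G.μ x * f x (u x) / r x with hq
  have hinj : Function.Injective fun x : V => (x, x) := fun x y e => (Prod.mk.inj e).1
  have hdiag : ∀ {k : V × V → ℝ}, Summable (fun p => k p ^ 2) → Summable fun x => k (x, x) ^ 2 :=
    fun hk => hk.comp_injective hinj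
  have hqsq : Summable fun x => q x ^ 2 := by
    refine Summable.of_nonneg_of_le (fun x => sq_nonneg _) (fun x => ?_)
      ((hdiag hJu).mul_left (C ^ 2 / h₀ ^ 2))
    have h1 : f x (u x) ^ 2 ≤ C ^ 2 * u x ^ 2 := by
      have := pow_le_pow_left₀ (abs_nonneg _) (hfC x) 2
      rwa [mul_pow, sq_abs, sq_abs] at this
    simp only [hq, energyVec_diag]
    rw [div_pow, hrsq, mul_pow, mul_pow, show √(h x * G.μ x) ^ 2 = h x * G.μ x from hrsq x,
      div_mul_eq_mul_div, div_le_div_iff₀ (mul_pos (hh' x) (G.μ_pos x)) (by positivity)]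
    have hμ := G.μ_pos x
    calc G.μ x ^ 2 * f x (u x) ^ 2 * h₀ ^ 2 ≤ G.μ x ^ 2 * (C ^ 2 * u x ^ 2) * h x ^ 2 := by
          have := hh x
          gcongr
      _ = C ^ 2 * (h x * G.μ x * u x ^ 2) * (h x * G.μ x) := by ring
  have hmul : ∀ (k : V → ℝ) x, G.energyVec s h k (x, x) * q x = f x (u x) * k x * G.μ x := by
    intro k x
    rw [energyVec_diag, hq]
    have := (hrpos x).ne'
    simp only [hr] at this ⊢
    field_simp
  have hJφ := fun n => hG.summable_energyVec_sq hs0 hs1 hh0 (hφ n)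
  have hsub : ∀ n, Summable fun p => (G.energyVec s h v p - G.energyVec s h (φ n) p) ^ 2 := fun n =>
    hJv.sub_sq (hJφ n)
  have hfv : Summable fun x => f x (u x) * v x * G.μ x := by
    simp only [← hmul v]
    exact (hdiag hJv).mul_of_sq hqsq
  have hfφ : ∀ n, Summable fun x => f x (u x) * φ n x * G.μ x := by
    intro n
    simp only [← hmul (φ n)]
    exact (hdiag (hJφ n)).mul_of_sq hqsq
  have hlim1 : Tendsto (fun n => ∑' p, G.energyVec s h u p * G.energyVec s h (φ n) p) atTop
      (𝓝 (∑' p, G.energyVec s h u p * G.energyVec s h v p)) := by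
    have h1 := (tendsto_tsum_mul_of_tendsto_tsum_sq hsub hJu hφv).const_sub
      (∑' p, G.energyVec s h u p * G.energyVec s h v p)
    rw [sub_zero] at h1
    refine h1.congr fun n => ?_
    rw [← (hJu.mul_of_sq hJv).tsum_sub ((hsub n).mul_of_sq hJu)]
    exact tsum_congr fun p => by ring
  have hlim2 : Tendsto (fun n => ∑' x, f x (u x) * φ n x * G.μ x) atTop
      (𝓝 (∑' x, f x (u x) * v x * G.μ x)) := by
    have h0 : Tendsto (fun n => ∑' x, (G.energyVec s h v (x, x) - G.energyVec s h (φ n) (x, x)) ^ 2)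
        atTop (𝓝 0) :=
      squeeze_zero (fun n => tsum_nonneg fun x => sq_nonneg _)
        (fun n => tsum_comp_le_tsum_of_inj (hsub n) (fun p => sq_nonneg _) hinj) hφv
    have h1 := (tendsto_tsum_mul_of_tendsto_tsum_sq (fun n => hdiag (hsub n)) hqsq h0).const_sub
      (∑' x, f x (u x) * v x * G.μ x)
    rw [sub_zero] at h1
    refine h1.congr fun n => ?_
    have h2 : ∀ x, (G.energyVec s h v (x, x) - G.energyVec s h (φ n) (x, x)) * q x =
        f x (u x) * v x * G.μ x - f x (u x) * φ n x * G.μ x := fun x => by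
      rw [sub_mul, hmul, hmul]
    simp only [h2]
    rw [hfv.tsum_sub (hfφ n)]
    ring
  have heq : ∀ n, ∑' p, G.energyVec s h u p * G.energyVec s h (φ n) p =
      ∑' x, f x (u x) * φ n x * G.μ x := by
    intro n
    have hS : ∀ x, x ∉ (hφ n).toFinset → φ n x = 0 := fun x hx => by simpa using hx
    rw [(hG.hasSum_energyVec_mul hs0 hs1 hh0 hS hub).tsum_eq,
      tsum_eq_sum (s := (hφ n).toFinset) fun x hx => by rw [hS x hx, mul_zero, zero_mul]]
    exact Finset.sum_congr rfl fun x _ => by rw [hu x]; ring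
  simp only [heq] at hlim1
  refine ⟨huv.summable, hfv, ?_⟩
  rw [integral, huv.tsum_eq]
  exact tendsto_nhds_unique hlim1 hlim2

theorem StochasticallyComplete.isPointwiseSolution (hG : G.StochasticallyComplete)
    (hs0 : 0 < s) (hs1 : s < 1) (hub : ∃ C, ∀ x, |u x| ≤ C)
    (hu : ∀ x, G.schrodinger s h u x = G.μ x * f x (u x)) : G.IsPointwiseSolution s h f u := by
  obtain ⟨C, hC⟩ := hub
  intro x
  refine ⟨hG.summable_fracKernel_mul hs0 hs1 x (abs_sub_le_two_mul hC x), ?_⟩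
  have h1 := hu x
  rw [schrodinger] at h1
  rw [fracLaplacian]
  have := (G.μ_pos x).ne'
  field_simp
  linarith

/-- The strong maximum principle. -/
theorem StochasticallyComplete.pos_of_schrodinger_eq (hG : G.StochasticallyComplete)
    (hconn : G.graph.Connected) (hs0 : 0 < s) (hs1 : s < 1) (hub : ∃ C, ∀ x, |u x| ≤ C)
    (hu0 : ∀ x, 0 ≤ u x) (hL : ∀ x, u x = 0 → G.schrodinger s h u x = 0) (hne : u ≠ 0) (x : V) :
    0 < u x := by
  obtain ⟨C, hC⟩ := hub
  -- At a zero y of u the equation reads ∑ W_s(y,z)u(z) = 0 with nonnegative terms, and W_s is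
  -- positive on edges.
  have hstep : ∀ {y z}, G.graph.Adj y z → u y = 0 → u z = 0 := by
    intro y z hyz hy
    have h1 := hL y hy
    simp only [schrodinger, hy, zero_sub, mul_neg, mul_zero, add_zero] at h1
    rw [tsum_neg, neg_eq_zero] at h1
    have hsum := hG.summable_fracKernel_mul hs0 hs1 y hC
    have hnn : ∀ z, 0 ≤ G.fracKernel s y z * u z := fun z =>
      mul_nonneg (G.fracKernel_nonneg hs0 hs1 y z) (hu0 z)
    have h2 : G.fracKernel s y z * u z = 0 := by
      have h3 := hsum.hasSum
      rw [h1, hasSum_zero_iff_of_nonneg hnn] at h3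
      exact congrFun h3 z
    exact (mul_eq_zero.1 h2).resolve_left (hG.fracKernel_pos_of_adj hs0 hs1 hyz).ne'
  refine (hu0 x).lt_of_ne' fun hx => hne (funext fun z => ?_)
  obtain ⟨p⟩ := hconn.preconnected x z
  induction p with
  | nil => exact hx
  | cons hadj _ ih => exact ih (hstep hadj hx)

end WeightedGraph

/-! ### Reflection, and the passage to the limit over finite sets -/

namespace WeightedGraph

variable {V : Type*} {G : WeightedGraph V} [G.graph.LocallyFinite] {s : ℝ} {h u : V → ℝ}
  {f : V → ℝ → ℝ}

theorem energyVec_neg (s : ℝ) (h u : V → ℝ) (p : V × V) :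
    G.energyVec s h (fun x => -u x) p = -G.energyVec s h u p := by
  simp only [energyVec]
  split_ifs <;> ring

theorem schrodinger_neg (s : ℝ) (h u : V → ℝ) (x : V) :
    G.schrodinger s h (fun x => -u x) x = -G.schrodinger s h u x := by
  rw [schrodinger, schrodinger, neg_add, ← tsum_neg]
  congr 1
  · exact tsum_congr fun y => by ring
  · ring

theorem StochasticallyComplete.neg_mem_hs (hG : G.StochasticallyComplete) (hs0 : 0 < s)
    (hs1 : s < 1) (hh : ∀ x, 0 ≤ h x) (hu : u ∈ G.hs s h) : (fun x => -u x) ∈ G.hs s h := by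
  rw [hG.mem_hs_iff hs0 hs1 hh] at hu ⊢
  obtain ⟨⟨C, hC⟩, hJ, φ, hφ, hlim⟩ := hu
  refine ⟨⟨C, fun x => by rw [abs_neg]; exact hC x⟩, by simpa only [energyVec_neg, neg_sq] using hJ,
    fun n x => -φ n x, fun n => by simpa [Function.support] using hφ n, ?_⟩
  refine hlim.congr fun n => tsum_congr fun p => ?_
  rw [energyVec_neg, energyVec_neg]
  ring

theorem StochasticallyComplete.exists_pos_schrodinger_eq (hG : G.StochasticallyComplete)
    (hconn : G.graph.Connected) (hs0 : 0 < s) (hs1 : s < 1) (hμ : ∃ μ₀ > 0, ∀ x, μ₀ ≤ G.μ x)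
    (h_lower : ∃ h₀ > 0, ∀ x, h₀ ≤ h x)
    (h_coercive : ∀ x₀, Tendsto h (comap (fun x => G.graph.dist x x₀) atTop) atTop)
    (F1 : ∀ x, Continuous (f x) ∧ f x 0 = 0)
    (F2 : ∀ M : ℝ, 0 < M → ∃ C : ℝ, ∀ x, ∀ y ∈ Icc (-M) M, |f x y| ≤ C) {α : ℝ} (hα : 2 < α)
    (F3 : ∀ x, ∀ y : ℝ, 0 < y → 0 < α * (∫ t in (0 : ℝ)..y, f x t) ∧
      α * (∫ t in (0 : ℝ)..y, f x t) ≤ y * f x y) {c δ : ℝ} (hcl : c < G.lambda1 s h) (hδ : 0 < δ)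
    (hc : ∀ x y, 0 < y → y < δ → f x y ≤ c * y) :
    ∃ u ∈ G.hs s h, (∀ x, 0 < u x) ∧ (∀ x, G.schrodinger s h u x = G.μ x * f x (u x)) ∧
      ∃ C, ∀ x, |f x (u x)| ≤ C * |u x| := by
  classical
  obtain ⟨μ₀, hμ₀, hμ⟩ := hμ
  obtain ⟨h₀, hh₀, hh⟩ := h_lower
  have hh' : ∀ x, 0 < h x := fun x => hh₀.trans_le (hh x)
  obtain ⟨x₀⟩ := hconn.nonempty
  have hfin := hconn.finite_sublevel (h_coercive x₀)
  have hfpos : ∀ x y, 0 < y → 0 < f x y := fun x y hy =>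
    pos_of_mul_pos_right ((F3 x y hy).1.trans_le (F3 x y hy).2) hy.le
  have hfnn : ∀ x y, 0 ≤ y → 0 ≤ f x y := by
    intro x y hy
    rcases hy.eq_or_lt with rfl | hy
    · exact (F1 x).2.ge
    · exact (hfpos x y hy).le
  have hc0 : 0 ≤ c := by
    have h1 := (hfpos x₀ (δ / 2) (by linarith)).trans_le (hc x₀ (δ / 2) (by linarith) (by linarith))
    exact (pos_of_mul_pos_left h1 (by linarith)).le
  obtain ⟨K, hK⟩ := hG.exists_dirichlet_solution hs0 hs1 hμ₀ hμ hh' F1 hα F3 hc0 hcl hδ hc x₀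
  -- Adjoining x₀ indexes the solutions by all finite sets, so the limit can be taken along `atTop`.
  choose w hw0 hsupp hsol hwK hwδ using fun D : Finset V => hK (insert x₀ D) (D.mem_insert_self x₀)
  have hwsq : ∀ D x, h x * μ₀ * w D x ^ 2 ≤ K := by
    intro D x
    have h1 := (hG.sum_mul_sq_le_energy hs0 hs1 (fun x => (hh' x).le) (hsupp D) {x}).trans (hwK D)
    rw [Finset.sum_singleton] at h1
    refine le_trans ?_ h1
    have := hμ x
    have := (hh' x).le
    gcongr
  set M := √(K / (h₀ * μ₀)) + 1 with hM
  have hM0 : 0 < M := by positivity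
  have hwM : ∀ D x, w D x ≤ M := by
    intro D x
    have h1 : w D x ^ 2 ≤ K / (h₀ * μ₀) := by
      rw [le_div_iff₀ (by positivity), mul_comm]
      refine le_trans ?_ (hwsq D x)
      have := hh x
      gcongr
    linarith [Real.le_sqrt_of_sq_le h1]
  obtain ⟨CM, hCM⟩ := F2 M hM0
  set C := max c (CM / δ) with hC
  have hfC : ∀ x y, 0 ≤ y → y ≤ M → 0 ≤ f x y ∧ f x y ≤ C * y := by
    intro x y hy hyM
    refine ⟨hfnn x y hy, ?_⟩
    rcases hy.eq_or_lt with rfl | hy0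
    · simp [(F1 x).2]
    rcases lt_or_ge y δ with hyδ | hyδ
    · exact (hc x y hy0 hyδ).trans (mul_le_mul_of_nonneg_right (le_max_left _ _) hy)
    · have h1 : f x y ≤ CM := (le_abs_self _).trans (hCM x y ⟨by linarith, hyM⟩)
      have h2 : 0 ≤ CM := (hfnn x y hy).trans h1
      calc f x y ≤ CM / δ * δ := by rwa [div_mul_cancel₀ _ hδ.ne']
        _ ≤ CM / δ * y := mul_le_mul_of_nonneg_left hyδ (div_nonneg h2 hδ.le)
        _ ≤ C * y := mul_le_mul_of_nonneg_right (le_max_right _ _) hy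
  -- The solutions lie in the compact product of intervals [0, M], so an ultrafilter finer than
  -- `atTop` yields a pointwise limit with no diagonal extraction.
  set U : Ultrafilter (Finset V) := Ultrafilter.of atTop
  have hU : (U : Filter (Finset V)) ≤ atTop := Ultrafilter.of_le _
  have hbox : Tendsto w U (𝓟 (univ.pi fun _ => Icc 0 M)) :=
    tendsto_principal.2 (Eventually.of_forall fun D x _ => ⟨hw0 D x, hwM D x⟩)
  obtain ⟨u, -, hu⟩ := (isCompact_univ_pi fun _ : V => isCompact_Icc (a := (0 : ℝ)) (b := M))
    |>.ultrafilter_le_nhds (U.map w) hbox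
  have hlim : ∀ x, Tendsto (fun D => w D x) U (𝓝 (u x)) := tendsto_pi_nhds.1 hu
  have hu0 : ∀ x, 0 ≤ u x := fun x => ge_of_tendsto' (hlim x) fun D => hw0 D x
  have huM : ∀ x, u x ≤ M := fun x => le_of_tendsto' (hlim x) fun D => hwM D x
  have hub : ∃ C, ∀ x, |u x| ≤ C := ⟨M, fun x => by rw [abs_of_nonneg (hu0 x)]; exact huM x⟩
  have hueq : ∀ x, G.schrodinger s h u x = G.μ x * f x (u x) := by
    intro x
    have h1 := hG.tendsto_schrodinger (h := h) hs0 hs1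
      (fun D x => by rw [abs_of_nonneg (hw0 D x)]; exact hwM D x) hlim x
    have h2 : Tendsto (fun D => G.μ x * f x (w D x)) U (𝓝 (G.μ x * f x (u x))) :=
      (((F1 x).1.tendsto _).comp (hlim x)).const_mul _
    refine tendsto_nhds_unique (h1.congr' ?_) h2
    filter_upwards [hU (eventually_ge_atTop {x})] with D hD
    exact hsol D x (Finset.mem_insert_of_mem (hD (Finset.mem_singleton_self x)))
  have hne : u ≠ 0 := by
    intro hzero
    -- A point where w ≥ δ satisfies hμ₀δ² ≤ K, so it lies in the finite set {h ≤ R}. Pointwise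
    -- convergence to 0 would be uniform there and push w below δ.
    set R := K / (μ₀ * δ ^ 2)
    have h1 : ∀ᶠ D in (U : Filter (Finset V)), ∀ x ∈ {x | h x ≤ R}, w D x < δ :=
      (hfin R).eventually_all.2 fun x _ => (hlim x).eventually_lt_const (by rw [hzero]; exact hδ)
    obtain ⟨D, hD⟩ := h1.exists
    obtain ⟨x, hx⟩ := hwδ D
    refine absurd (hD x ?_) (not_lt.2 hx)
    show h x ≤ R
    rw [le_div_iff₀ (by positivity), ← mul_assoc]
    refine le_trans ?_ (hwsq D x)
    have := (hh' x).le
    gcongr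
  have hmem : u ∈ G.hs s h := hG.mem_hs_of_tendsto hs0 hs1 hh₀ hh hfin (fun x => (F1 x).1) hfC hw0
    hwM hsupp hsol hwK hlim hueq
  refine ⟨u, hmem, hG.pos_of_schrodinger_eq (h := h) hconn hs0 hs1 hub hu0 (fun x hx => ?_) hne,
    hueq, C,
    fun x => ?_⟩
  · rw [hueq, hx, (F1 x).2, mul_zero]
  · rw [abs_of_nonneg (hu0 x), abs_of_nonneg (hfnn x _ (hu0 x))]
    exact (hfC x _ (hu0 x) (huM x)).2

end WeightedGraph

theorem theorem2p4 {V : Type*} (G : WeightedGraph V) [G.graph.LocallyFinite]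
    (hconn : G.graph.Connected) (hstoch : G.StochasticallyComplete)
    (hμ : ∃ μ₀ > 0, ∀ x, μ₀ ≤ G.μ x)
    (s : ℝ) (hs0 : 0 < s) (hs1 : s < 1)
    (h : V → ℝ) (h_lower : ∃ h₀ > 0, ∀ x, h₀ ≤ h x)
    (h_coercive : ∀ x₀, Tendsto h (comap (fun x => G.graph.dist x x₀) atTop) atTop)
    (f : V → ℝ → ℝ)
    (F1 : ∀ x, Continuous (f x) ∧ f x 0 = 0)
    (F2 : ∀ M : ℝ, 0 < M → ∃ C : ℝ, ∀ x, ∀ y ∈ Icc (-M) M, |f x y| ≤ C)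
    (F3 : ∃ α : ℝ, 2 < α ∧ ∀ x, ∀ y : ℝ, y ≠ 0 →
      0 < α * (∫ t in (0 : ℝ)..y, f x t) ∧ α * (∫ t in (0 : ℝ)..y, f x t) ≤ y * f x y)
    (F4 : ∃ c < G.lambda1 s h, ∀ᶠ y in 𝓝[≠] (0 : ℝ), ∀ x, f x y / y ≤ c) :
    (∃ u ∈ G.hs s h, G.IsWeakSolution s h f u ∧ G.IsPointwiseSolution s h f u ∧ ∀ x, 0 < u x) ∧
    (∃ v ∈ G.hs s h, G.IsWeakSolution s h f v ∧ G.IsPointwiseSolution s h f v ∧ ∀ x, v x < 0) := by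
  obtain ⟨α, hα, F3⟩ := F3
  obtain ⟨c, hcl, F4⟩ := F4
  rw [eventually_nhdsWithin_iff, Metric.eventually_nhds_iff] at F4
  obtain ⟨δ, hδ, F4⟩ := F4
  obtain ⟨h₀, hh₀, hh⟩ := h_lower
  have hh0 : ∀ x, 0 ≤ h x := fun x => hh₀.le.trans (hh x)
  constructor
  · obtain ⟨u, hmem, hpos, hueq, C, hC⟩ := hstoch.exists_pos_schrodinger_eq hconn hs0 hs1 hμ
      ⟨h₀, hh₀, hh⟩ h_coercive F1 F2 hα (fun x y hy => F3 x y hy.ne') hcl hδ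
      fun x y hy hyδ => (div_le_iff₀ hy).1 (F4 (by simpa [abs_of_pos hy] using hyδ) hy.ne' x)
    exact ⟨u, hmem, hstoch.isWeakSolution hs0 hs1 hh₀ hh hC hmem hueq,
      hstoch.isPointwiseSolution hs0 hs1 hmem.1 hueq, hpos⟩
  -- The reflected nonlinearity -f(x,-y) has primitive F(x,-y), so (F1)–(F4) carry over; λ₁ does not
  -- involve f.
  · have hint : ∀ x y, ∫ t in (0 : ℝ)..y, -f x (-t) = ∫ t in (0 : ℝ)..(-y), f x t := by
      intro x y
      rw [intervalIntegral.integral_neg, intervalIntegral.integral_comp_neg fun t => f x t,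
        neg_zero,
        ← intervalIntegral.integral_symm]
    obtain ⟨u, hmem, hpos, hueq, C, hC⟩ := hstoch.exists_pos_schrodinger_eq
      (f := fun x y => -f x (-y)) hconn hs0 hs1 hμ ⟨h₀, hh₀, hh⟩ h_coercive
      (fun x => ⟨((F1 x).1.comp continuous_neg).neg, by simp [(F1 x).2]⟩)
      (fun M hM => (F2 M hM).imp fun C hC x y hy => by
        rw [abs_neg]
        exact hC x (-y) ⟨by linarith [hy.2], by linarith [hy.1]⟩)
      hα (fun x y hy => by
        rw [hint, mul_neg, ← neg_mul]
        exact F3 x (-y) (neg_ne_zero.2 hy.ne'))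
      hcl hδ fun x y hy hyδ => by
        have h1 := F4 (y := -y) (by simpa [abs_of_pos hy] using hyδ) (neg_ne_zero.2 hy.ne') x
        rwa [div_neg, ← neg_div, div_le_iff₀ hy] at h1
    have hveq : ∀ x, G.schrodinger s h (fun x => -u x) x = G.μ x * f x (-u x) := fun x => by
      rw [WeightedGraph.schrodinger_neg, hueq]
      ring
    have hvmem := hstoch.neg_mem_hs hs0 hs1 hh0 hmem
    refine ⟨fun x => -u x, hvmem, hstoch.isWeakSolution hs0 hs1 hh₀ hh (C := C) (fun x => ?_) hvmem
      hveq, hstoch.isPointwiseSolution hs0 hs1 hvmem.1 hveq, fun x => neg_neg_of_pos (hpos x)⟩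
    simpa using hC x
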